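/- Let $U$ be a two-qubit controlled-unitary operation, i.e. $U=(v_1\otimes v_2)\,(|0\rangle\langle 0|\otimes I+|1\rangle\langle 1|\otimes u)\,(w_1\otimes w_2)$ with single-qubit unitaries $u,v_1,v_2,w_1,w_2$. Two two-qubit operations are called locally equivalent if they differ only by multiplication on the left and on the right with tensor products of single-qubit unitaries. Assume that $U$ is not locally equivalent to the identity (equivalently, $U$ is locally equivalent to $U_\theta=\mathrm{diag}(1,1,1,e^{i\theta})$ for some $\theta$ with $e^{i\theta}\neq 1$). For a bipartite unit vector $|\psi\rangle\in\mathbb C^m\otimes\mathbb C^n$, the Schmidt number is the number of its nonzero Schmidt coefficients, $|\psi\rangle$ is called maximally entangled if its nonzero Schmidt coefficients are all equal, and its entanglement is the base-2 entropy $E(\psi)=-\sum_i s_i^2\log_2 s_i^2$ of its Schmidt coefficients $s_i$, measured in ebits. An LOCC protocol consists of finitely many turns; at each turn Alice or Bob performs, on her or his own finite-dimensional system, a generalized measurement with finitely many outcomes (measurement operators $M^{(r)}$ with $\sum_r M^{(r)\dagger}M^{(r)}=I$, possibly changing the dimension of the local system) and announces the outcome, on which all later choices may depend. The protocol realizes a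 completely positive trace-preserving map $\Gamma$, and it implements $U$ deterministically with resource $|\psi\rangle$ if $\Gamma(\rho\otimes|\psi\rangle\langle\psi|)=U\rho U^\dagger$ for all two-qubit density operators $\rho$, where Alice holds the first input qubit and the factor $\mathbb C^m$, and Bob holds the second input qubit and the factor $\mathbb C^n$. Then: 1. If some LOCC protocol implements $U$ deterministically with a pure resource state $|\psi\rangle$ of Schmidt number $2$, then $|\psi\rangle$ is maximally entangled, and so $E(\psi)=1$ ebit. 2. Conversely, every maximally entangled pure state of Schmidt number $2$ is a resource with which $U$ can be implemented deterministically by an LOCC protocol with three turns. 3. Consequently, the minimum entanglement cost of $U$ over pure resource states of Schmidt number $2$, i.e. the least $E(\psi)$ over all $|\psi\rangle$ of Schmidt number $2$ with which $U$ can be implemented deterministically by LOCC, is exactly $1$ ebit. 4. Let the entangling power of $U$ be the supremum of the entanglement of the states that $U$ creates from pure product states of Alice and Bob (with local ancillas of arbitrary finite dimension allowed). It is at most $1$ ebit, and it is strictly less than $1$ ebit if and only if $U$ is not locally equivalent to the controlled-NOT operation. Hence for every such $U$ not locally equivalent to the controlled-NOT there is a gap between the minimum entanglement cost of part 3 and the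 entangling power. -/

import Mathlib

open scoped Matrix Kronecker ComplexOrder

noncomputable section

namespace LOCCCost

/-- Operators on two qubits; the first index is Alice's qubit, the second is Bob's. -/
abbrev TwoQubitOp : Type := Matrix (Fin 2 × Fin 2) (Fin 2 × Fin 2) ℂ

/-- The controlled operation `|0⟩⟨0| ⊗ 1 + |1⟩⟨1| ⊗ u`. -/
def controlled (u : Matrix (Fin 2) (Fin 2) ℂ) : TwoQubitOp :=
  Matrix.single 0 0 1 ⊗ₖ 1 + Matrix.single 1 1 1 ⊗ₖ u

/-- The controlled-NOT operation. -/
def cnot : TwoQubitOp := controlled !![0, 1; 1, 0]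

/-- `U = (v₁ ⊗ v₂) V (w₁ ⊗ w₂)` with single-qubit unitaries `v₁, v₂, w₁, w₂`. -/
def LocallyEquivalent (U V : TwoQubitOp) : Prop :=
  ∃ v₁ v₂ w₁ w₂ : Matrix.unitaryGroup (Fin 2) ℂ,
    U = ((v₁ : Matrix (Fin 2) (Fin 2) ℂ) ⊗ₖ (v₂ : Matrix (Fin 2) (Fin 2) ℂ)) * V *
      ((w₁ : Matrix (Fin 2) (Fin 2) ℂ) ⊗ₖ (w₂ : Matrix (Fin 2) (Fin 2) ℂ))

/-- Two-qubit controlled-unitary operations, up to local unitaries. -/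
def IsControlledUnitary (U : TwoQubitOp) : Prop :=
  ∃ u : Matrix.unitaryGroup (Fin 2) ℂ, LocallyEquivalent U (controlled u)

/-- Unit vectors, in coordinates. -/
def IsPureState {ι : Type*} [Fintype ι] (ψ : ι → ℂ) : Prop :=
  ∑ x, ‖ψ x‖ ^ 2 = 1

/-- Density operators. -/
def IsDensity {ι : Type*} [Fintype ι] (ρ : Matrix ι ι ℂ) : Prop :=
  ρ.PosSemidef ∧ ρ.trace = 1

section Schmidt

variable {A B : Type*} [Fintype A] [DecidableEq A] [Fintype B]

/-- The coefficient matrix `ψ_{ij}` of a bipartite vector. -/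
def coeffMatrix (ψ : A × B → ℂ) : Matrix A B ℂ := Matrix.of fun i j => ψ (i, j)

/-- The reduced operator `Tr_B |ψ⟩⟨ψ|`. -/
def reduced (ψ : A × B → ℂ) : Matrix A A ℂ := coeffMatrix ψ * (coeffMatrix ψ)ᴴ

theorem reduced_isHermitian {A B : Type*} [Fintype B] (ψ : A × B → ℂ) : (reduced ψ).IsHermitian :=
  Matrix.isHermitian_mul_conjTranspose_self _

/-- The Schmidt coefficients of `ψ` (padded by zeros): the square roots of the eigenvalues,
with multiplicity, of the reduced operator. -/
def schmidtCoeff (ψ : A × B → ℂ) (i : A) : ℝ :=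
  Real.sqrt ((reduced_isHermitian ψ).eigenvalues i)

/-- The Schmidt number: the number of nonzero Schmidt coefficients. -/
def schmidtNumber (ψ : A × B → ℂ) : ℕ := Nat.card {i : A // schmidtCoeff ψ i ≠ 0}

/-- All nonzero Schmidt coefficients are equal. -/
def IsMaximallyEntangled (ψ : A × B → ℂ) : Prop :=
  ∀ i j, schmidtCoeff ψ i ≠ 0 → schmidtCoeff ψ j ≠ 0 → schmidtCoeff ψ i = schmidtCoeff ψ j

/-- Entropy of entanglement, in ebits. -/
def entanglement (ψ : A × B → ℂ) : ℝ :=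
  -∑ i, schmidtCoeff ψ i ^ 2 * Real.logb 2 (schmidtCoeff ψ i ^ 2)

end Schmidt

/-- Two-party LOCC protocols with finitely many turns. `LOCC c d a b` takes Alice's system from
dimension `a` to `c` and Bob's from `b` to `d`. At each turn one of the parties performs a
generalized measurement with finitely many outcomes `r` and announces the outcome; everything
afterwards may depend on it. The measurement operators are only subject to completeness, and may
change the dimension of the local system (ancillas may be adjoined or discarded). -/
inductive LOCC (c d : ℕ) : ℕ → ℕ → Type
  | done : LOCC c d c d
  | alice {a b : ℕ} (k : ℕ) (a' : Fin k → ℕ)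
      (M : (r : Fin k) → Matrix (Fin (a' r)) (Fin a) ℂ)
      (complete : ∑ r, (M r)ᴴ * M r = 1)
      (next : (r : Fin k) → LOCC c d (a' r) b) : LOCC c d a b
  | bob {a b : ℕ} (k : ℕ) (b' : Fin k → ℕ)
      (K : (r : Fin k) → Matrix (Fin (b' r)) (Fin b) ℂ)
      (complete : ∑ r, (K r)ᴴ * K r = 1)
      (next : (r : Fin k) → LOCC c d a (b' r)) : LOCC c d a b

namespace LOCC

/-- The number of turns (length of the longest branch). -/
def turns {c d : ℕ} : {a b : ℕ} → LOCC c d a b → ℕ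
  | _, _, done => 0
  | _, _, alice _ _ _ _ next => 1 + Finset.univ.sup fun r => (next r).turns
  | _, _, bob _ _ _ _ next => 1 + Finset.univ.sup fun r => (next r).turns

/-- The completely positive trace-preserving map realized by a protocol. -/
def channel {c d : ℕ} : {a b : ℕ} → LOCC c d a b →
    Matrix (Fin a × Fin b) (Fin a × Fin b) ℂ → Matrix (Fin c × Fin d) (Fin c × Fin d) ℂ
  | _, _, done, ρ => ρ
  | _, b, alice _ _ M _ next, ρ =>
      ∑ r, (next r).channel
        ((M r ⊗ₖ (1 : Matrix (Fin b) (Fin b) ℂ)) * ρ *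
          (M r ⊗ₖ (1 : Matrix (Fin b) (Fin b) ℂ))ᴴ)
  | a, _, bob _ _ K _ next, ρ =>
      ∑ r, (next r).channel
        (((1 : Matrix (Fin a) (Fin a) ℂ) ⊗ₖ K r) * ρ *
          ((1 : Matrix (Fin a) (Fin a) ℂ) ⊗ₖ K r)ᴴ)

end LOCC

/-- The operator `ρ_in ⊗ |ψ⟩⟨ψ|`, with the factors grouped by party: Alice holds
`ℂ² ⊗ ℂᵐ ≅ ℂ²ᵐ` and Bob holds `ℂ² ⊗ ℂⁿ ≅ ℂ²ⁿ`. -/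
def jointState {m n : ℕ} (ρ : TwoQubitOp) (ψ : Fin m × Fin n → ℂ) :
    Matrix (Fin (2 * m) × Fin (2 * n)) (Fin (2 * m) × Fin (2 * n)) ℂ :=
  Matrix.of fun x y =>
    let x₁ := finProdFinEquiv.symm x.1
    let x₂ := finProdFinEquiv.symm x.2
    let y₁ := finProdFinEquiv.symm y.1
    let y₂ := finProdFinEquiv.symm y.2
    ρ (x₁.1, x₂.1) (y₁.1, y₂.1) * (ψ (x₁.2, x₂.2) * star (ψ (y₁.2, y₂.2)))

/-- The protocol `P`, assisted by the resource `ψ`, implements `U` deterministically on every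
(unknown) input state. -/
def Implements {m n : ℕ} (P : LOCC 2 2 (2 * m) (2 * n)) (ψ : Fin m × Fin n → ℂ)
    (U : TwoQubitOp) : Prop :=
  ∀ ρ : TwoQubitOp, IsDensity ρ → P.channel (jointState ρ ψ) = U * ρ * Uᴴ

/-- The vector obtained by applying `U` to the two qubits of the product vector `α ⊗ β`, where each
party's qubit comes with a local ancilla. -/
def applyToProduct {p q : ℕ} (U : TwoQubitOp) (α : Fin 2 × Fin p → ℂ) (β : Fin 2 × Fin q → ℂ) :
    (Fin 2 × Fin p) × (Fin 2 × Fin q) → ℂ :=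
  fun x => ∑ i : Fin 2, ∑ j : Fin 2, U (x.1.1, x.2.1) (i, j) * (α (i, x.1.2) * β (j, x.2.2))

/-- Entangling power: the supremum of the entanglement that `U` creates from pure product states
(local ancillas of any finite dimension allowed). -/
def entanglingPower (U : TwoQubitOp) : EReal :=
  ⨆ (p : ℕ) (q : ℕ) (α : Fin 2 × Fin p → ℂ) (β : Fin 2 × Fin q → ℂ)
    (_ : IsPureState α) (_ : IsPureState β), (entanglement (applyToProduct U α β) : EReal)

end LOCCCost

end

/-!
A protocol is a separable operation, with Kraus operators `E k ⊗ F k`. Since a unitary channel is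
extremal, each of them acts as a multiple `z k • U` on the inputs joined with the resource. A
controlled unitary that is not locally trivial is a sum of two terms `A i ⊗ B i` with linearly
independent `A` and `B`, and a resource of Schmidt number 2 is an isometry with two terms of weights
`s o`. Pairing `E k` and `F k` with dual bases of `A` and `B`, one obtains two square matrices that
are inverse to each other up to `s` and `z k`, and inverses commute: exchanging the factors and
summing over `k` with the completeness relation gives `2 * |s o| ^ 2 = ∑ k, |z k| ^ 2` for both `o`.

Conversely, with `∑ o, |oo⟩ / √2` Alice measures the parity of her input and her half of the
resource, after which Bob's half carries her control bit. Bob applies the controlled gate and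
measures that half in the Hadamard basis, and Alice removes the resulting phase.

If `U` applies `G a` to Bob's qubit when Alice's is in the state `a`, then a product input in which
the control has probabilities `g, 1 - g` and Bob's state is `β` has an output with Schmidt weights
`t, 1 - t`, where `(t - 1/2)² = (g - 1/2)² + g (1 - g) |k|²` and `k = ⟨β, (G 0)ᴴ (G 1) β⟩`. For a
unitary `u` of size 2, Cayley–Hamilton reads `u + det u • uᴴ = tr u • 1`, so with `u = (G 0)ᴴ (G 1)`
the overlap satisfies `|tr u| ≤ 2 |k|`. Hence `t` stays away from `1/2` unless `tr u = 0`, which is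
the case of the controlled-NOT.
-/

noncomputable section

namespace LOCCCost

section Kraus

variable {a b c d : Type*} [DecidableEq a] [DecidableEq b]

/-- Separable operations from a system with parts `a`, `b` to a system with parts `c`, `d`: the
trace-preserving maps all of whose Kraus operators are product operators `E k ⊗ F k`. -/
def IsSeparableOperation [Fintype a] [Fintype b] [Fintype c] [Fintype d]
    (Φ : Matrix (a × b) (a × b) ℂ → Matrix (c × d) (c × d) ℂ) : Prop :=
  ∃ (κ : Type) (_ : Fintype κ) (E : κ → Matrix c a ℂ) (F : κ → Matrix d b ℂ),
    ∑ k, (E k ⊗ₖ F k)ᴴ * (E k ⊗ₖ F k) = 1 ∧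
      ∀ ρ, Φ ρ = ∑ k, (E k ⊗ₖ F k) * ρ * (E k ⊗ₖ F k)ᴴ

theorem IsSeparableOperation.id [Fintype a] [Fintype b] :
    IsSeparableOperation (id : Matrix (a × b) (a × b) ℂ → Matrix (a × b) (a × b) ℂ) :=
  ⟨Unit, inferInstance, fun _ => 1, fun _ => 1, by simp, by simp⟩

theorem IsSeparableOperation.sum_comp [Fintype a] [Fintype b] [Fintype c] [Fintype d]
    {κ : Type} [Fintype κ]
    {a' b' : κ → Type*} [∀ r, Fintype (a' r)] [∀ r, Fintype (b' r)]
    [∀ r, DecidableEq (a' r)] [∀ r, DecidableEq (b' r)]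
    {M : (r : κ) → Matrix (a' r) a ℂ} {K : (r : κ) → Matrix (b' r) b ℂ}
    (hMK : ∑ r, (M r ⊗ₖ K r)ᴴ * (M r ⊗ₖ K r) = 1)
    {Φ : (r : κ) → Matrix (a' r × b' r) (a' r × b' r) ℂ → Matrix (c × d) (c × d) ℂ}
    (hΦ : ∀ r, IsSeparableOperation (Φ r)) :
    IsSeparableOperation fun ρ : Matrix (a × b) (a × b) ℂ =>
      ∑ r, Φ r ((M r ⊗ₖ K r) * ρ * (M r ⊗ₖ K r)ᴴ) := by
  choose ι hι E F hEF hΦEF using hΦ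
  refine ⟨Σ r, ι r, inferInstance, fun x => E x.1 x.2 * M x.1, fun x => F x.1 x.2 * K x.1, ?_, ?_⟩
  · calc ∑ x : Σ r, ι r, ((E x.1 x.2 * M x.1) ⊗ₖ (F x.1 x.2 * K x.1))ᴴ *
          ((E x.1 x.2 * M x.1) ⊗ₖ (F x.1 x.2 * K x.1))
        = ∑ r, (M r ⊗ₖ K r)ᴴ * (∑ i, (E r i ⊗ₖ F r i)ᴴ * (E r i ⊗ₖ F r i)) *
            (M r ⊗ₖ K r) := by
          simp only [Fintype.sum_sigma, Matrix.mul_kronecker_mul, Matrix.conjTranspose_mul,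
            Matrix.mul_sum, Matrix.sum_mul, Matrix.mul_assoc]
      _ = 1 := by simp only [hEF, Matrix.mul_one, hMK]
  · intro ρ
    simp only [Fintype.sum_sigma, hΦEF, Matrix.mul_kronecker_mul, Matrix.conjTranspose_mul,
      Matrix.mul_assoc]

theorem sum_kronecker_one_complete [Fintype b] {κ : Type*} [Fintype κ]
    {a' : κ → Type*} [∀ r, Fintype (a' r)] {M : (r : κ) → Matrix (a' r) a ℂ}
    (hM : ∑ r, (M r)ᴴ * M r = 1) :
    ∑ r, (M r ⊗ₖ (1 : Matrix b b ℂ))ᴴ * (M r ⊗ₖ (1 : Matrix b b ℂ)) = 1 := by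
  rw [← Matrix.one_kronecker_one, ← hM]
  ext x y
  simp [Matrix.conjTranspose_kronecker, ← Matrix.mul_kronecker_mul, Matrix.sum_apply,
    Finset.sum_mul]

theorem sum_one_kronecker_complete [Fintype a] {κ : Type*} [Fintype κ]
    {b' : κ → Type*} [∀ r, Fintype (b' r)] {K : (r : κ) → Matrix (b' r) b ℂ}
    (hK : ∑ r, (K r)ᴴ * K r = 1) :
    ∑ r, ((1 : Matrix a a ℂ) ⊗ₖ K r)ᴴ * ((1 : Matrix a a ℂ) ⊗ₖ K r) = 1 := by
  rw [← Matrix.one_kronecker_one, ← hK]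
  ext x y
  simp [Matrix.conjTranspose_kronecker, ← Matrix.mul_kronecker_mul, Matrix.sum_apply,
    Finset.mul_sum]

end Kraus

theorem LOCC.isSeparableOperation_channel {c d a b : ℕ} (P : LOCC c d a b) :
    IsSeparableOperation P.channel := by
  induction P with
  | done => exact .id
  | alice _ _ _ complete _ ih => exact .sum_comp (sum_kronecker_one_complete complete) ih
  | bob _ _ _ complete _ ih => exact .sum_comp (sum_one_kronecker_complete complete) ih

section UnitaryConjugation

variable {ι κ : Type*} [Fintype ι]

theorem star_dotProduct_conj_vecMulVec_mulVec {ι' : Type*} [Fintype ι'] (A : Matrix ι' ι ℂ)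
    (v : ι → ℂ) (x : ι' → ℂ) :
    star x ⬝ᵥ ((A * Matrix.vecMulVec v (star v) * Aᴴ) *ᵥ x) = (‖star x ⬝ᵥ (A *ᵥ v)‖ ^ 2 : ℝ) := by
  rw [Matrix.mul_vecMulVec, Matrix.vecMulVec_mul, ← Matrix.star_mulVec, Matrix.vecMulVec_mulVec,
    dotProduct_smul, MulOpposite.smul_eq_mul_unop, MulOpposite.unop_op, Matrix.star_dotProduct,
    Complex.ofReal_pow, ← Complex.mul_conj', Complex.star_def,
    Complex.conj_conj]

theorem exists_eq_smul_one_of_preserves_orthogonality [DecidableEq ι] {A : Matrix ι ι ℂ}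
    (hA : ∀ v w : ι → ℂ, star w ⬝ᵥ v = 0 → star w ⬝ᵥ (A *ᵥ v) = 0) : ∃ c : ℂ, A = c • 1 := by
  have off_diag : ∀ i j, i ≠ j → A i j = 0 := fun i j hij => by
    simpa using hA (Pi.single j 1) (Pi.single i 1) (by simp [hij])
  have diag : ∀ i j, A i i = A j j := fun i j => by
    rcases eq_or_ne i j with rfl | hij
    · rfl
    have := hA (Pi.single i 1 + Pi.single j 1) (Pi.single i 1 - Pi.single j 1)
      (by simp [hij, hij.symm, dotProduct_add])
    simp only [star_sub, ← Pi.single_star, star_one, Matrix.mulVec_add,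
      Matrix.mulVec_single_one, dotProduct_add, sub_dotProduct, single_one_dotProduct,
      Matrix.col_apply, off_diag i j hij, off_diag j i hij.symm] at this
    linear_combination this
  rcases isEmpty_or_nonempty ι with _ | ⟨⟨i₀⟩⟩
  · exact ⟨0, Subsingleton.elim _ _⟩
  refine ⟨A i₀ i₀, ?_⟩
  ext i j
  rcases eq_or_ne i j with rfl | hij
  · simp [diag i i₀]
  · simp [off_diag i j hij, hij]

theorem exists_eq_smul_of_sum_kraus_eq_unitary [DecidableEq ι] [Fintype κ] {U : Matrix ι ι ℂ}
    (hU : Uᴴ * U = 1) {N : κ → Matrix ι ι ℂ}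
    (hN : ∀ v : ι → ℂ, ∑ k, N k * Matrix.vecMulVec v (star v) * (N k)ᴴ =
      U * Matrix.vecMulVec v (star v) * Uᴴ) (k : κ) : ∃ c : ℂ, N k = c • U := by
  have norm_sq : ∀ v x : ι → ℂ,
      ∑ k, ‖star x ⬝ᵥ (N k *ᵥ v)‖ ^ 2 = ‖star x ⬝ᵥ (U *ᵥ v)‖ ^ 2 := fun v x => by
    have := congrArg (fun A => star x ⬝ᵥ (A *ᵥ x)) (hN v)
    simp only [Matrix.sum_mulVec, dotProduct_sum, star_dotProduct_conj_vecMulVec_mulVec] at this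
    exact_mod_cast this
  obtain ⟨c, hc⟩ : ∃ c : ℂ, Uᴴ * N k = c • 1 := by
    refine exists_eq_smul_one_of_preserves_orthogonality fun v w hvw => ?_
    have star_mulVec_dotProduct : ∀ A : Matrix ι ι ℂ,
        star (U *ᵥ w) ⬝ᵥ (A *ᵥ v) = star w ⬝ᵥ ((Uᴴ * A) *ᵥ v) := fun A => by
      rw [Matrix.star_mulVec, ← Matrix.dotProduct_mulVec, Matrix.mulVec_mulVec]
    have := norm_sq v (U *ᵥ w)
    simp only [star_mulVec_dotProduct, hU, Matrix.one_mulVec, hvw, norm_zero] at this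
    rw [zero_pow two_ne_zero, Finset.sum_eq_zero_iff_of_nonneg fun _ _ => sq_nonneg _] at this
    exact norm_eq_zero.1 (pow_eq_zero_iff two_ne_zero |>.1 (this k (Finset.mem_univ _)))
  refine ⟨c, ?_⟩
  rw [← Matrix.one_mul (N k), ← mul_eq_one_comm.1 hU, Matrix.mul_assoc, hc, Matrix.mul_smul,
    Matrix.mul_one]

end UnitaryConjugation

section SchmidtDecomposition

theorem trace_reduced {A B : Type*} [Fintype A] [Fintype B] (ψ : A × B → ℂ) :
    (reduced ψ).trace = ((∑ x, ‖ψ x‖ ^ 2 : ℝ) : ℂ) := by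
  simp only [reduced, coeffMatrix, Matrix.trace, Matrix.diag_apply, Matrix.mul_apply,
    Matrix.conjTranspose_apply, Matrix.of_apply, Complex.star_def, Complex.mul_conj',
    Fintype.sum_prod_type, Complex.ofReal_sum, Complex.ofReal_pow]

variable {A B : Type*} [Fintype A] [DecidableEq A] [Fintype B] (ψ : A × B → ℂ)

theorem schmidtCoeff_sq (i : A) :
    schmidtCoeff ψ i ^ 2 = (reduced_isHermitian ψ).eigenvalues i :=
  Real.sq_sqrt ((Matrix.posSemidef_self_mul_conjTranspose (coeffMatrix ψ)).eigenvalues_nonneg i)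

/-- The indices of the nonzero Schmidt coefficients of `ψ`. -/
abbrev SchmidtIndex : Type _ := {i : A // schmidtCoeff ψ i ≠ 0}

theorem card_schmidtIndex : Fintype.card (SchmidtIndex ψ) = schmidtNumber ψ :=
  Nat.card_eq_fintype_card.symm

theorem exists_unitary_orthogonal_rows : ∃ V : Matrix.unitaryGroup A ℂ, ∀ i j,
    star ((star V.1 * coeffMatrix ψ) i) ⬝ᵥ (star V.1 * coeffMatrix ψ) j =
      if i = j then (schmidtCoeff ψ i : ℂ) ^ 2 else 0 := by
  have hR := reduced_isHermitian ψ
  refine ⟨hR.eigenvectorUnitary, fun i j => ?_⟩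
  set V : Matrix A A ℂ := hR.eigenvectorUnitary.1
  have diagonalizes : (star V * coeffMatrix ψ) * (star V * coeffMatrix ψ)ᴴ =
      Matrix.diagonal fun i => ((schmidtCoeff ψ i : ℂ)) ^ 2 := by
    calc (star V * coeffMatrix ψ) * (star V * coeffMatrix ψ)ᴴ = star V * reduced ψ * V := by
          simp only [reduced, Matrix.star_eq_conjTranspose, Matrix.conjTranspose_mul,
            Matrix.conjTranspose_conjTranspose, Matrix.mul_assoc]
      _ = Matrix.diagonal (RCLike.ofReal ∘ hR.eigenvalues) := by
          simpa [Unitary.conjStarAlgAut_apply] using hR.conjStarAlgAut_star_eigenvectorUnitary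
      _ = _ := by
          congr 1 with i
          simp [← schmidtCoeff_sq]
  rw [dotProduct_comm]
  refine (congrFun₂ diagonalizes j i).trans ?_
  rcases eq_or_ne i j with rfl | hij
  · simp
  · simp [hij, hij.symm]

theorem exists_schmidt_decomposition :
    ∃ (p : SchmidtIndex ψ → A → ℂ) (q : SchmidtIndex ψ → B → ℂ),
      (∀ i j, star (p i) ⬝ᵥ p j = if i = j then 1 else 0) ∧
      (∀ i j, star (q i) ⬝ᵥ q j = if i = j then 1 else 0) ∧
      ∀ x, ψ x = ∑ i : SchmidtIndex ψ, (schmidtCoeff ψ i : ℂ) * (p i x.1 * q i x.2) := by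
  obtain ⟨V, row_inner⟩ := exists_unitary_orthogonal_rows ψ
  set M := star V.1 * coeffMatrix ψ with hM
  have coeff_ne_zero : ∀ i : SchmidtIndex ψ, (schmidtCoeff ψ i : ℂ) ≠ 0 :=
    fun i => Complex.ofReal_ne_zero.2 i.2
  have row_eq_zero : ∀ i, schmidtCoeff ψ i = 0 → M i = 0 := fun i hi => by
    simpa [hi] using row_inner i i
  have coeffMatrix_eq : coeffMatrix ψ = V.1 * M := by
    rw [hM, ← Matrix.mul_assoc, ← Unitary.coe_star, Unitary.coe_mul_star_self, Matrix.one_mul]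
  refine ⟨fun i x => V.1 x i, fun i => (schmidtCoeff ψ i : ℂ)⁻¹ • M i,
    fun i j => ?_, fun i j => ?_, fun x => ?_⟩
  · refine (congrFun₂ (Unitary.coe_star_mul_self V) i j).trans ?_
    simp [Matrix.one_apply, Subtype.ext_iff]
  · rw [star_smul, smul_dotProduct, dotProduct_smul, row_inner]
    rcases eq_or_ne i j with rfl | hij
    · simp [pow_two, coeff_ne_zero i]
    · simp [hij, Subtype.coe_ne_coe.2 hij]
  · calc ψ x = ∑ i, V.1 x.1 i * M i x.2 := congrFun₂ coeffMatrix_eq x.1 x.2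
      _ = ∑ i : SchmidtIndex ψ, V.1 x.1 i * M i x.2 := by
        refine (Fintype.sum_of_injective _ Subtype.val_injective _ _ (fun i hi => ?_)
          fun _ => rfl).symm
        rw [row_eq_zero i (by simpa using hi), Pi.zero_apply, mul_zero]
      _ = _ := Finset.sum_congr rfl fun i _ => by
        simp only [Pi.smul_apply, smul_eq_mul]
        field_simp [coeff_ne_zero i]

variable {ψ}

theorem sum_schmidtCoeff_sq (hψ : IsPureState ψ) : ∑ i, schmidtCoeff ψ i ^ 2 = 1 := by
  have trace_eq : (reduced ψ).trace = ((∑ i, schmidtCoeff ψ i ^ 2 : ℝ) : ℂ) := by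
    simp only [(reduced_isHermitian ψ).trace_eq_sum_eigenvalues, schmidtCoeff_sq,
      Complex.ofReal_sum, Complex.coe_algebraMap]
  rw [trace_reduced, hψ] at trace_eq
  exact_mod_cast trace_eq.symm

theorem IsMaximallyEntangled.schmidtCoeff_sq_eq (hmax : IsMaximallyEntangled ψ)
    (hψ : IsPureState ψ) {i : A} (hi : schmidtCoeff ψ i ≠ 0) :
    schmidtCoeff ψ i ^ 2 = (schmidtNumber ψ : ℝ)⁻¹ := by
  have : schmidtNumber ψ * schmidtCoeff ψ i ^ 2 = 1 := by
    rw [← card_schmidtIndex, ← sum_schmidtCoeff_sq hψ, ← nsmul_eq_mul, ← Finset.card_univ,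
      ← Finset.sum_const]
    refine Fintype.sum_of_injective _ Subtype.val_injective _ _ (fun j hj => ?_)
      fun j => by rw [hmax i j hi j.2]
    rw [show schmidtCoeff ψ j = 0 by simpa using hj, zero_pow two_ne_zero]
  exact eq_inv_of_mul_eq_one_right this

theorem IsMaximallyEntangled.entanglement_eq (hmax : IsMaximallyEntangled ψ)
    (hψ : IsPureState ψ) : entanglement ψ = Real.logb 2 (schmidtNumber ψ) := by
  have summand : ∀ i, schmidtCoeff ψ i ^ 2 * Real.logb 2 (schmidtCoeff ψ i ^ 2) =
      schmidtCoeff ψ i ^ 2 * -Real.logb 2 (schmidtNumber ψ) := fun i => by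
    by_cases hi : schmidtCoeff ψ i = 0
    · simp [hi]
    · rw [hmax.schmidtCoeff_sq_eq hψ hi, Real.logb_inv]
  rw [entanglement, Finset.sum_congr rfl fun i _ => summand i, ← Finset.sum_mul,
    sum_schmidtCoeff_sq hψ, one_mul, neg_neg]

theorem schmidtCoeff_eq_sqrt_of_reduced_eq_smul_one {t : ℝ} (h : reduced ψ = (t : ℂ) • 1)
    (i : A) : schmidtCoeff ψ i = Real.sqrt t := by
  have : Nonempty A := ⟨i⟩
  have h' : reduced ψ = algebraMap ℝ (Matrix A A ℂ) t := by
    rw [h, Algebra.algebraMap_eq_smul_one]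
    ext i j
    simp
  have spectrum_eq : spectrum ℝ (reduced ψ) = {t} := by rw [h', spectrum.scalar_eq]
  have := spectrum_eq ▸ (reduced_isHermitian ψ).eigenvalues_mem_spectrum_real i
  rw [schmidtCoeff, Set.mem_singleton_iff.1 this]

end SchmidtDecomposition

section Rigidity

variable {a b c d x y ρ σ κ : Type*}

theorem exists_dual_of_linearIndependent {V : Type*} [AddCommGroup V] [Module ℂ V]
    [DecidableEq ρ] {A : ρ → V} (hA : LinearIndependent ℂ A) :
    ∃ α : ρ → V →ₗ[ℂ] ℂ, ∀ i j, α i (A j) = if i = j then 1 else 0 := by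
  obtain ⟨g, hg⟩ := (Finsupp.linearCombination ℂ A).exists_leftInverse_of_injective
    (LinearMap.ker_eq_bot.2 hA)
  refine ⟨fun i => Finsupp.lapply i ∘ₗ g, fun i j => ?_⟩
  have : g (A j) = Finsupp.single j 1 := by
    simpa using LinearMap.congr_fun hg (Finsupp.single j 1)
  simp [this, Finsupp.single_apply, eq_comm]

/-- The functional on operators of a bipartite system whose value at `A ⊗ B` is `α A * β B`. -/
def prodFunctional (α : Matrix a c ℂ →ₗ[ℂ] ℂ) (β : Matrix b d ℂ →ₗ[ℂ] ℂ) :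
    Matrix (a × b) (c × d) ℂ →ₗ[ℂ] ℂ :=
  α ∘ₗ β.mapMatrix ∘ₗ (Matrix.compLinearEquiv a c b d ℂ ℂ).symm.toLinearMap

theorem prodFunctional_kronecker (α : Matrix a c ℂ →ₗ[ℂ] ℂ) (β : Matrix b d ℂ →ₗ[ℂ] ℂ)
    (A : Matrix a c ℂ) (B : Matrix b d ℂ) : prodFunctional α β (A ⊗ₖ B) = α A * β B := by
  have : β.mapMatrix ((Matrix.compLinearEquiv a c b d ℂ ℂ).symm (A ⊗ₖ B)) = β B • A := by
    ext i j
    have : (Matrix.compLinearEquiv a c b d ℂ ℂ).symm (A ⊗ₖ B) i j = A i j • B := rfl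
    rw [LinearMap.mapMatrix_apply, Matrix.map_apply, this, map_smul, Matrix.smul_apply,
      smul_eq_mul, smul_eq_mul, mul_comm]
  rw [prodFunctional, LinearMap.comp_apply, LinearMap.comp_apply, LinearEquiv.coe_coe, this,
    map_smul, smul_eq_mul, mul_comm]

/-- Isometries with pairwise orthogonal ranges. -/
def IsOrthogonalIsometries [Fintype x] [DecidableEq c] [DecidableEq σ] (P : σ → Matrix x c ℂ) :
    Prop :=
  ∀ i j, (P i)ᴴ * P j = if i = j then 1 else 0

variable [Fintype ρ] [Fintype σ] [Fintype κ]

theorem sum_dual_mul_dual_eq [DecidableEq ρ]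
    (hcard : Fintype.card ρ = Fintype.card σ) {A : ρ → Matrix a c ℂ} {B : ρ → Matrix b d ℂ}
    {α : ρ → Matrix a c ℂ →ₗ[ℂ] ℂ} {β : ρ → Matrix b d ℂ →ₗ[ℂ] ℂ}
    (hα : ∀ i j, α i (A j) = if i = j then 1 else 0)
    (hβ : ∀ i j, β i (B j) = if i = j then 1 else 0)
    {e : σ → Matrix a c ℂ} {f : σ → Matrix b d ℂ} {s : σ → ℂ} {z : ℂ} (hz : z ≠ 0)
    (h : ∑ o, s o • (e o ⊗ₖ f o) = z • ∑ i, A i ⊗ₖ B i) (o : σ) :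
    s o * ∑ i, α i (e o) * β i (f o) = z := by
  classical
  let X : Matrix ρ σ ℂ := Matrix.of fun i o => α i (e o)
  let Y : Matrix σ ρ ℂ := Matrix.of fun o i => z⁻¹ * (s o * β i (f o))
  have X_mul_Y : X * Y = 1 := by
    ext i j
    have := congrArg (prodFunctional (α i) (β j)) h
    simp only [map_sum, map_smul, prodFunctional_kronecker, hα, hβ, smul_eq_mul, ite_mul, one_mul,
      zero_mul, Finset.sum_ite_eq, Finset.mem_univ, if_true] at this
    calc ∑ o, α i (e o) * (z⁻¹ * (s o * β j (f o)))
        = z⁻¹ * ∑ o, s o * (α i (e o) * β j (f o)) := by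
          rw [Finset.mul_sum]
          exact Finset.sum_congr rfl fun o _ => by ring
      _ = (1 : Matrix ρ ρ ℂ) i j := by
          rw [this, inv_mul_cancel_left₀ hz, Matrix.one_apply]
          simp only [eq_comm]
  have Y_mul_X : Y * X = 1 := (Matrix.mul_eq_one_comm_of_card_eq _ _ _ hcard).1 X_mul_Y
  have : ∑ i, z⁻¹ * (s o * β i (f o)) * α i (e o) = 1 := by
    simpa [Matrix.mul_apply, X, Y] using congrFun₂ Y_mul_X o o
  calc s o * ∑ i, α i (e o) * β i (f o) = z * ∑ i, z⁻¹ * (s o * β i (f o)) * α i (e o) := by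
        rw [Finset.mul_sum, Finset.mul_sum]
        exact Finset.sum_congr rfl fun i _ => by field_simp
    _ = z := by rw [this, mul_one]

/-- The equation `∑ o, s o • (e k o ⊗ f k o) = z k • U` says that the dual coordinates of `e k` and
`f k` are mutually inverse square matrices up to the factor `z k`; exchanging them turns it into
the diagonal part of the adjoint relation. -/
theorem card_mul_weight_eq_of_kraus_blocks (hcard : Fintype.card ρ = Fintype.card σ)
    {A : ρ → Matrix a c ℂ} {B : ρ → Matrix b d ℂ} (hA : LinearIndependent ℂ A)
    (hB : LinearIndependent ℂ B) {e : κ → σ → Matrix a c ℂ} {f : κ → σ → Matrix b d ℂ}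
    {s : σ → ℂ} {z : κ → ℂ}
    (hblock : ∀ k, ∑ o, s o • (e k o ⊗ₖ f k o) = z k • ∑ i, A i ⊗ₖ B i)
    (hadj : ∀ o, ∑ k, star (z k) • (e k o ⊗ₖ f k o) = star (s o) • ∑ i, A i ⊗ₖ B i) (o : σ) :
    Fintype.card ρ * (s o * star (s o)) = ∑ k, star (z k) * z k := by
  classical
  obtain ⟨α, hα⟩ := exists_dual_of_linearIndependent hA
  obtain ⟨β, hβ⟩ := exists_dual_of_linearIndependent hB
  have hadj_dual : ∀ i, ∑ k, star (z k) * (α i (e k o) * β i (f k o)) = star (s o) := fun i => by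
    have := congrArg (prodFunctional (α i) (β i)) (hadj o)
    simpa [prodFunctional_kronecker, hα, hβ] using this
  calc (Fintype.card ρ : ℂ) * (s o * star (s o))
      = s o * ∑ i, ∑ k, star (z k) * (α i (e k o) * β i (f k o)) := by
        simp only [hadj_dual, Finset.sum_const, Finset.card_univ, nsmul_eq_mul]
        ring
    _ = ∑ k, star (z k) * (s o * ∑ i, α i (e k o) * β i (f k o)) := by
        rw [Finset.sum_comm, Finset.mul_sum]
        simp only [← Finset.mul_sum, mul_left_comm]
    _ = ∑ k, star (z k) * z k := Finset.sum_congr rfl fun k _ => by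
        rcases eq_or_ne (z k) 0 with hk | hk
        · simp [hk]
        · rw [sum_dual_mul_dual_eq hcard hα hβ hk (hblock k)]

/-- The right-hand side does not depend on `o`: a separable operation that undoes the isometry
`∑ o, s o • (P o ⊗ Q o)` up to a unitary of equal operator Schmidt rank forces equal weights. -/
theorem card_mul_weight_eq_of_kraus [Fintype a] [Fintype b] [Fintype c] [Fintype d]
    [Fintype x] [Fintype y] [DecidableEq a] [DecidableEq b] [DecidableEq c] [DecidableEq d]
    [DecidableEq x] [DecidableEq y] [DecidableEq σ]
    (hcard : Fintype.card ρ = Fintype.card σ)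
    {A : ρ → Matrix a c ℂ} {B : ρ → Matrix b d ℂ} (hA : LinearIndependent ℂ A)
    (hB : LinearIndependent ℂ B)
    (hU : (∑ i, A i ⊗ₖ B i) * (∑ i, A i ⊗ₖ B i)ᴴ = 1)
    {P : σ → Matrix x c ℂ} {Q : σ → Matrix y d ℂ} (hP : IsOrthogonalIsometries P)
    (hQ : IsOrthogonalIsometries Q) {s : σ → ℂ} {E : κ → Matrix a x ℂ} {F : κ → Matrix b y ℂ}
    (hEF : ∑ k, (E k ⊗ₖ F k)ᴴ * (E k ⊗ₖ F k) = 1) {z : κ → ℂ}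
    (hz : ∀ k, (E k ⊗ₖ F k) * ∑ o, s o • (P o ⊗ₖ Q o) = z k • ∑ i, A i ⊗ₖ B i) (o : σ) :
    Fintype.card ρ * (s o * star (s o)) = ∑ k, star (z k) * z k := by
  set U := ∑ i, A i ⊗ₖ B i
  set J := ∑ o, s o • (P o ⊗ₖ Q o) with J_def
  have J_adjoint : ∀ o, Jᴴ * (P o ⊗ₖ Q o) = star (s o) • 1 := fun o => by
    simp only [J_def, Matrix.conjTranspose_sum, Matrix.conjTranspose_smul,
      Matrix.conjTranspose_kronecker, Matrix.sum_mul, Matrix.smul_mul,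
      ← Matrix.mul_kronecker_mul, hP _ o, hQ _ o]
    rw [Finset.sum_eq_single o (fun o' _ ho' => by simp [ho']) (by simp)]
    simp
  have J_adjoint_kraus : ∀ k, Jᴴ * (E k ⊗ₖ F k)ᴴ = star (z k) • Uᴴ := fun k => by
    rw [← Matrix.conjTranspose_mul, hz, Matrix.conjTranspose_smul]
  refine card_mul_weight_eq_of_kraus_blocks hcard hA hB (e := fun k o => E k * P o)
    (f := fun k o => F k * Q o) (fun k => ?_) (fun o' => ?_) o
  · simp only [Matrix.mul_kronecker_mul, ← Matrix.mul_smul, ← Matrix.mul_sum]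
    exact hz k
  · calc ∑ k, star (z k) • ((E k * P o') ⊗ₖ (F k * Q o'))
        = U * (Jᴴ * (∑ k, (E k ⊗ₖ F k)ᴴ * (E k ⊗ₖ F k)) * (P o' ⊗ₖ Q o')) := by
          simp only [Matrix.mul_sum, Matrix.sum_mul, ← Matrix.mul_assoc, Matrix.mul_kronecker_mul]
          simp only [Matrix.mul_assoc _ Jᴴ, J_adjoint_kraus, Matrix.mul_smul, Matrix.smul_mul, hU,
            Matrix.one_mul]
      _ = star (s o') • U := by
          rw [hEF, Matrix.mul_one, J_adjoint, Matrix.mul_smul, Matrix.mul_one]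

end Rigidity

section Resource

/-- The map `φ ↦ φ ⊗ v` that adjoins an ancilla in the state `v` to a `k`-dimensional system, for
the identification `ℂᵏ ⊗ ℂᵐ ≅ ℂᵏᵐ` used in `jointState`. -/
def adjoinAncilla (k : ℕ) {m : ℕ} (v : Fin m → ℂ) : Matrix (Fin (k * m)) (Fin k) ℂ :=
  Matrix.of fun x i =>
    if (finProdFinEquiv.symm x).1 = i then v (finProdFinEquiv.symm x).2 else 0

theorem conjTranspose_adjoinAncilla_mul_adjoinAncilla (k : ℕ) {m : ℕ} (v w : Fin m → ℂ) :
    (adjoinAncilla k v)ᴴ * adjoinAncilla k w = (star v ⬝ᵥ w) • 1 := by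
  ext i j
  rw [Matrix.mul_apply, ← finProdFinEquiv.sum_comp, Fintype.sum_prod_type]
  simp only [Matrix.conjTranspose_apply, adjoinAncilla, Matrix.of_apply, Equiv.symm_apply_apply,
    Matrix.smul_apply, Matrix.one_apply, dotProduct, Pi.star_apply, smul_eq_mul]
  rcases eq_or_ne i j with rfl | hij
  · simp
  · simp [hij, hij.symm]

theorem isOrthogonalIsometries_adjoinAncilla (k : ℕ) {m : ℕ} {σ : Type*} [DecidableEq σ]
    {p : σ → Fin m → ℂ} (hp : ∀ i j, star (p i) ⬝ᵥ p j = if i = j then 1 else 0) :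
    IsOrthogonalIsometries fun i => adjoinAncilla k (p i) := fun i j => by
  rw [conjTranspose_adjoinAncilla_mul_adjoinAncilla, hp, ite_smul, one_smul, zero_smul]

variable {m n : ℕ} {ψ : Fin m × Fin n → ℂ}

/-- The map `φ ↦ φ ⊗ ψ` that adjoins the resource `ψ` to two qubits, with the factors grouped by
party. -/
def adjoinResource (ψ : Fin m × Fin n → ℂ) :
    Matrix (Fin (2 * m) × Fin (2 * n)) (Fin 2 × Fin 2) ℂ :=
  Matrix.of fun x y =>
    if ((finProdFinEquiv.symm x.1).1, (finProdFinEquiv.symm x.2).1) = y then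
      ψ ((finProdFinEquiv.symm x.1).2, (finProdFinEquiv.symm x.2).2) else 0

theorem jointState_eq_adjoinResource (ρ : TwoQubitOp) (ψ : Fin m × Fin n → ℂ) :
    jointState ρ ψ = adjoinResource ψ * ρ * (adjoinResource ψ)ᴴ := by
  ext x y
  simp only [jointState, adjoinResource, Matrix.of_apply, Matrix.mul_apply,
    Matrix.conjTranspose_apply, ite_mul, zero_mul, Finset.sum_ite_eq, Finset.mem_univ, if_true,
    apply_ite star, star_zero, mul_ite, mul_zero]
  ring

theorem adjoinResource_eq_sum {σ : Type*} [Fintype σ] {s : σ → ℂ} {p : σ → Fin m → ℂ}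
    {q : σ → Fin n → ℂ} (hψ : ∀ x, ψ x = ∑ o, s o * (p o x.1 * q o x.2)) :
    adjoinResource ψ = ∑ o, s o • (adjoinAncilla 2 (p o) ⊗ₖ adjoinAncilla 2 (q o)) := by
  ext x y
  simp [adjoinResource, adjoinAncilla, hψ, Matrix.sum_apply, Prod.ext_iff, ← ite_and, and_comm]

theorem Implements.channel_jointState_of_posSemidef {P : LOCC 2 2 (2 * m) (2 * n)}
    {U : TwoQubitOp} (hP : Implements P ψ U) {ρ : TwoQubitOp} (hρ : ρ.PosSemidef) :
    P.channel (jointState ρ ψ) = U * ρ * Uᴴ := by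
  obtain ⟨κ, _, E, F, -, channel_eq⟩ := P.isSeparableOperation_channel
  rcases eq_or_ne ρ.trace 0 with trace_zero | trace_ne_zero
  · rw [hρ.trace_eq_zero_iff.1 trace_zero, channel_eq, jointState_eq_adjoinResource]
    simp
  · have density : IsDensity (ρ.trace⁻¹ • ρ) :=
      ⟨hρ.smul (inv_nonneg.2 hρ.trace_nonneg), by simp [Matrix.trace_smul, trace_ne_zero]⟩
    have := congrArg (fun A => ρ.trace • A) (hP _ density)
    rw [channel_eq, jointState_eq_adjoinResource] at this ⊢
    simpa [Finset.smul_sum, smul_smul, trace_ne_zero] using this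

theorem Implements.exists_kraus_eq_smul {P : LOCC 2 2 (2 * m) (2 * n)} {U : TwoQubitOp}
    (hP : Implements P ψ U) (hU : Uᴴ * U = 1) :
    ∃ (κ : Type) (_ : Fintype κ) (E : κ → Matrix (Fin 2) (Fin (2 * m)) ℂ)
      (F : κ → Matrix (Fin 2) (Fin (2 * n)) ℂ) (z : κ → ℂ),
      ∑ k, (E k ⊗ₖ F k)ᴴ * (E k ⊗ₖ F k) = 1 ∧
        ∀ k, (E k ⊗ₖ F k) * adjoinResource ψ = z k • U := by
  obtain ⟨κ, hκ, E, F, complete, channel_eq⟩ := P.isSeparableOperation_channel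
  choose z hz using exists_eq_smul_of_sum_kraus_eq_unitary hU
    (N := fun k => (E k ⊗ₖ F k) * adjoinResource ψ) fun v => by
      rw [← hP.channel_jointState_of_posSemidef (Matrix.posSemidef_vecMulVec_self_star v),
        channel_eq, jointState_eq_adjoinResource]
      simp only [Matrix.conjTranspose_mul, Matrix.mul_assoc]
  exact ⟨κ, hκ, E, F, z, complete, hz⟩

theorem Implements.isMaximallyEntangled {P : LOCC 2 2 (2 * m) (2 * n)} {U : TwoQubitOp}
    (hP : Implements P ψ U) (hU : Uᴴ * U = 1) {ρ : Type*} [Fintype ρ]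
    {A B : ρ → Matrix (Fin 2) (Fin 2) ℂ} (hA : LinearIndependent ℂ A)
    (hB : LinearIndependent ℂ B) (hAB : U = ∑ i, A i ⊗ₖ B i)
    (hcard : Fintype.card ρ = schmidtNumber ψ) : IsMaximallyEntangled ψ := by
  obtain ⟨p, q, hp, hq, decomposition⟩ := exists_schmidt_decomposition ψ
  obtain ⟨κ, _, E, F, z, complete, kraus_eq⟩ := hP.exists_kraus_eq_smul hU
  rw [adjoinResource_eq_sum decomposition] at kraus_eq
  subst hAB
  have weight : ∀ o : SchmidtIndex ψ,
      (Fintype.card ρ : ℂ) * (schmidtCoeff ψ o * star (schmidtCoeff ψ o : ℂ)) =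
        ∑ k, star (z k) * z k :=
    card_mul_weight_eq_of_kraus (hcard.trans (card_schmidtIndex ψ).symm) hA hB
      (mul_eq_one_comm.1 hU) (isOrthogonalIsometries_adjoinAncilla 2 hp)
      (isOrthogonalIsometries_adjoinAncilla 2 hq) complete kraus_eq
  intro i j hi hj
  have card_ne_zero : (Fintype.card ρ : ℂ) ≠ 0 := by
    rw [hcard, ← card_schmidtIndex, Nat.cast_ne_zero]
    exact (Fintype.card_pos_iff.2 ⟨⟨i, hi⟩⟩).ne'
  have := mul_left_cancel₀ card_ne_zero ((weight ⟨i, hi⟩).trans (weight ⟨j, hj⟩).symm)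
  simp only [Complex.star_def, Complex.conj_ofReal, ← pow_two] at this
  exact (pow_left_inj₀ (Real.sqrt_nonneg _) (Real.sqrt_nonneg _) two_ne_zero).1
    (by exact_mod_cast this)

end Resource

section LocalEquivalence

theorem LocallyEquivalent.trans {U V W : TwoQubitOp} (hUV : LocallyEquivalent U V)
    (hVW : LocallyEquivalent V W) : LocallyEquivalent U W := by
  obtain ⟨v₁, v₂, w₁, w₂, rfl⟩ := hUV
  obtain ⟨x₁, x₂, y₁, y₂, rfl⟩ := hVW
  refine ⟨v₁ * x₁, v₂ * x₂, y₁ * w₁, y₂ * w₂, ?_⟩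
  simp only [Submonoid.coe_mul, Matrix.mul_kronecker_mul, Matrix.mul_assoc]

/-- The diagonal unitary gate with the phases `z i`. -/
def diagonalGate (z : Fin 2 → ℂ) (hz : ∀ i, ‖z i‖ = 1) : Matrix.unitaryGroup (Fin 2) ℂ :=
  ⟨Matrix.diagonal z, by
    rw [Matrix.mem_unitaryGroup_iff, Matrix.star_eq_conjTranspose, Matrix.diagonal_conjTranspose,
      Matrix.diagonal_mul_diagonal, ← Matrix.diagonal_one]
    congr 1 with i
    simp [Complex.mul_conj', hz]⟩

/-- The uniformly controlled gate that applies `G a` to the second qubit when the first one is in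
the state `a`, between the local gates `w` and `v` on the first qubit. -/
def multiplexer (v w : Matrix.unitaryGroup (Fin 2) ℂ) (G : Fin 2 → Matrix.unitaryGroup (Fin 2) ℂ) :
    TwoQubitOp :=
  ∑ a, (v.1 * Matrix.single a a 1 * w.1) ⊗ₖ (G a).1

variable {v w : Matrix.unitaryGroup (Fin 2) ℂ} {G : Fin 2 → Matrix.unitaryGroup (Fin 2) ℂ}

theorem kronecker_mul_controlled_mul_kronecker (u v₁ v₂ w₁ w₂ : Matrix.unitaryGroup (Fin 2) ℂ) :
    (v₁.1 ⊗ₖ v₂.1) * controlled u * (w₁.1 ⊗ₖ w₂.1) =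
      multiplexer v₁ w₁ ![v₂ * w₂, v₂ * u * w₂] := by
  simp [multiplexer, controlled, Matrix.mul_add, Matrix.add_mul, ← Matrix.mul_kronecker_mul]

theorem IsControlledUnitary.exists_eq_multiplexer {U : TwoQubitOp} (hU : IsControlledUnitary U) :
    ∃ v w G, U = multiplexer v w G := by
  obtain ⟨u, v₁, v₂, w₁, w₂, rfl⟩ := hU
  exact ⟨v₁, w₁, _, kronecker_mul_controlled_mul_kronecker u v₁ v₂ w₁ w₂⟩

theorem multiplexer_conjTranspose_mul_self :
    (multiplexer v w G)ᴴ * multiplexer v w G = 1 := by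
  have hv : v.1ᴴ * v.1 = 1 := Unitary.coe_star_mul_self v
  have hw : w.1ᴴ * w.1 = 1 := Unitary.coe_star_mul_self w
  have hG : ∀ a, (G a).1ᴴ * (G a).1 = 1 := fun a => Unitary.coe_star_mul_self (G a)
  have cross : ∀ a b, (v.1 * Matrix.single a a 1 * w.1)ᴴ * (v.1 * Matrix.single b b 1 * w.1) =
      if a = b then w.1ᴴ * Matrix.single a a 1 * w.1 else 0 := fun a b => by
    calc (v.1 * Matrix.single a a 1 * w.1)ᴴ * (v.1 * Matrix.single b b 1 * w.1)
        = w.1ᴴ * (Matrix.single a a 1 * (v.1ᴴ * v.1) * Matrix.single b b 1) * w.1 := by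
          simp only [Matrix.conjTranspose_mul, Matrix.conjTranspose_single, star_one,
            Matrix.mul_assoc]
      _ = _ := by
          rw [hv, Matrix.mul_one]
          rcases eq_or_ne a b with rfl | hab
          · simp
          · simp [hab]
  calc (multiplexer v w G)ᴴ * multiplexer v w G
      = ∑ a, (w.1ᴴ * Matrix.single a a 1 * w.1) ⊗ₖ 1 := by
        simp only [multiplexer, Matrix.conjTranspose_sum, Matrix.conjTranspose_kronecker,
          Matrix.sum_mul, Matrix.mul_sum, ← Matrix.mul_kronecker_mul, cross]
        simp [hG]
    _ = (w.1ᴴ * (∑ a, Matrix.single a a 1) * w.1) ⊗ₖ 1 := by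
        simp only [Fin.sum_univ_two, Matrix.add_kronecker, Matrix.mul_add, Matrix.add_mul]
    _ = 1 := by
        rw [Matrix.sum_single_one, Matrix.mul_one, hw, Matrix.one_kronecker_one]

theorem multiplexer_locallyEquivalent_controlled :
    LocallyEquivalent (multiplexer v w G) (controlled (star (G 0) * G 1)) := by
  refine ⟨v, G 0, w, 1, ?_⟩
  have := kronecker_mul_controlled_mul_kronecker (star (G 0) * G 1) v (G 0) w 1
  rw [← Submonoid.coe_mul, this]
  congr
  ext1 a
  fin_cases a <;> simp [← mul_assoc]

theorem multiplexer_locallyEquivalent_one {z : ℂ} (hz : z • (G 1).1 = (G 0).1) :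
    LocallyEquivalent (multiplexer v w G) 1 := by
  have norm_z : ‖z‖ = 1 := by
    have h0 : (G 0).1 * (G 0).1ᴴ = 1 := Unitary.coe_mul_star_self (G 0)
    have h1 : (G 1).1 * (G 1).1ᴴ = 1 := Unitary.coe_mul_star_self (G 1)
    rw [← hz, Matrix.conjTranspose_smul, Matrix.smul_mul, Matrix.mul_smul, h1, smul_smul] at h0
    have := congrFun₂ h0 0 0
    rw [Matrix.smul_apply, Matrix.one_apply_eq, smul_eq_mul, mul_one, Complex.star_def,
      Complex.mul_conj'] at this
    exact (pow_eq_one_iff_of_nonneg (norm_nonneg z) two_ne_zero).1 (by exact_mod_cast this)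
  let d : Matrix.unitaryGroup (Fin 2) ℂ :=
    diagonalGate ![z, 1] (by simp [Fin.forall_fin_two, norm_z])
  have d_eq : d.1 = z • Matrix.single 0 0 1 + Matrix.single 1 1 1 := by
    ext i j
    fin_cases i <;> fin_cases j <;> simp [d, diagonalGate]
  refine ⟨v * d * w, G 1, 1, 1, ?_⟩
  rw [Submonoid.coe_mul, Submonoid.coe_mul, d_eq]
  simp only [multiplexer, Fin.sum_univ_two, ← hz, Matrix.mul_add, Matrix.add_mul, Matrix.mul_smul,
    Matrix.smul_mul, Matrix.add_kronecker, Matrix.smul_kronecker, Matrix.kronecker_smul,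
    Submonoid.coe_one, Matrix.one_kronecker_one, Matrix.mul_one]

theorem linearIndependent_mul_single_mul :
    LinearIndependent ℂ fun a => v.1 * Matrix.single a a 1 * w.1 := by
  have hv : v.1ᴴ * v.1 = 1 := Unitary.coe_star_mul_self v
  have hw : w.1 * w.1ᴴ = 1 := Unitary.coe_mul_star_self w
  refine Fintype.linearIndependent_iff.2 fun g hg a => ?_
  have sum_single : ∑ a, g a • Matrix.single a a (1 : ℂ) = 0 := by
    calc ∑ a, g a • Matrix.single a a (1 : ℂ)
        = (v.1ᴴ * v.1) * (∑ a, g a • Matrix.single a a 1) * (w.1 * w.1ᴴ) := by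
          rw [hv, hw, Matrix.one_mul, Matrix.mul_one]
      _ = v.1ᴴ * (∑ a, g a • (v.1 * Matrix.single a a 1 * w.1)) * w.1ᴴ := by
          simp only [Fin.sum_univ_two, Matrix.mul_add, Matrix.add_mul, Matrix.mul_smul,
            Matrix.smul_mul, Matrix.mul_assoc]
      _ = 0 := by rw [hg, Matrix.mul_zero, Matrix.zero_mul]
  simpa [Matrix.sum_apply, Matrix.single_apply] using congrFun₂ sum_single a a

theorem linearIndependent_of_not_locallyEquivalent_one
    (h : ¬ LocallyEquivalent (multiplexer v w G) 1) : LinearIndependent ℂ fun a => (G a).1 := by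
  refine linearIndependent_fin2.2 ⟨fun h1 => ?_,
    fun z hz => h (multiplexer_locallyEquivalent_one hz)⟩
  have : (G 1).1ᴴ * (G 1).1 = 1 := Unitary.coe_star_mul_self (G 1)
  simp [h1] at this

end LocalEquivalence

section ControlledNot

theorem norm_apply_zero_one_eq_norm_apply_one_zero (u : Matrix.unitaryGroup (Fin 2) ℂ) :
    ‖u.1 0 1‖ = ‖u.1 1 0‖ := by
  have row : (u.1 * u.1ᴴ) 0 0 = 1 := congrFun₂ (Unitary.coe_mul_star_self u) 0 0
  have column : (u.1ᴴ * u.1) 0 0 = 1 := congrFun₂ (Unitary.coe_star_mul_self u) 0 0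
  simp only [Matrix.mul_apply, Fin.sum_univ_two, Matrix.conjTranspose_apply, Complex.star_def,
    Complex.mul_conj', Complex.conj_mul'] at row column
  have sq_eq : ‖u.1 0 1‖ ^ 2 = ‖u.1 1 0‖ ^ 2 := by
    exact_mod_cast add_left_cancel (row.trans column.symm)
  exact (pow_left_inj₀ (norm_nonneg _) (norm_nonneg _) two_ne_zero).1 sq_eq

theorem exists_norm_eq_one_sq_mul_eq_neg {b c : ℂ} (h : ‖b‖ = ‖c‖) :
    ∃ τ : ℂ, ‖τ‖ = 1 ∧ τ ^ 2 * b = -c := by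
  rcases eq_or_ne b 0 with rfl | hb
  · exact ⟨1, norm_one, by simpa [eq_comm] using h⟩
  obtain ⟨τ, hτ⟩ := IsAlgClosed.exists_pow_nat_eq (-c / b) two_pos
  refine ⟨τ, ?_, by rw [hτ, div_mul_cancel₀ _ hb]⟩
  refine (pow_eq_one_iff_of_nonneg (norm_nonneg τ) two_ne_zero).1 ?_
  rw [← norm_pow, hτ, norm_div, norm_neg, ← h, div_self (norm_ne_zero_iff.2 hb)]

theorem exists_unit_orthogonal_mulVec_of_trace_eq_zero {u : Matrix.unitaryGroup (Fin 2) ℂ}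
    (hu : u.1.trace = 0) :
    ∃ e : Fin 2 → ℂ, star e ⬝ᵥ e = 1 ∧ star e ⬝ᵥ (u.1 *ᵥ e) = 0 := by
  obtain ⟨τ, hτ, hbc⟩ :=
    exists_norm_eq_one_sq_mul_eq_neg (norm_apply_zero_one_eq_norm_apply_one_zero u)
  have conj_mul : starRingEnd ℂ τ * τ = 1 := by
    rw [Complex.conj_mul', hτ, Complex.ofReal_one, one_pow]
  have s_sq : ((√2 : ℝ) : ℂ)⁻¹ * ((√2 : ℝ) : ℂ)⁻¹ = 1 / 2 := by
    rw [← mul_inv, ← Complex.ofReal_mul, Real.mul_self_sqrt zero_le_two]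
    norm_num
  rw [Matrix.trace_fin_two] at hu
  refine ⟨((√2 : ℝ) : ℂ)⁻¹ • ![1, τ], ?_, ?_⟩
  · simp only [dotProduct, Pi.star_apply, Pi.smul_apply, Fin.sum_univ_two, smul_eq_mul,
      Complex.star_def, Matrix.cons_val_zero, Matrix.cons_val_one, Matrix.cons_val_fin_one,
      map_inv₀, Complex.conj_ofReal, map_mul, map_one]
    linear_combination (1 + starRingEnd ℂ τ * τ) * s_sq + conj_mul / 2
  · simp only [dotProduct, Matrix.mulVec, Pi.star_apply, Pi.smul_apply, Fin.sum_univ_two,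
      smul_eq_mul, Complex.star_def, Matrix.cons_val_zero, Matrix.cons_val_one,
      Matrix.cons_val_fin_one, map_inv₀, Complex.conj_ofReal, map_mul, map_one]
    linear_combination
      s_sq * (u.1 0 0 + u.1 0 1 * τ + starRingEnd ℂ τ * (u.1 1 0 + u.1 1 1 * τ)) + hu / 2
        + starRingEnd ℂ τ / 2 * hbc + conj_mul * (u.1 1 1 - τ * u.1 0 1) / 2

theorem add_det_smul_conjTranspose (u : Matrix.unitaryGroup (Fin 2) ℂ) :
    u.1 + u.1.det • u.1ᴴ = u.1.trace • 1 := by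
  have mul_conjTranspose : u.1 * u.1ᴴ = 1 := Unitary.coe_mul_star_self u
  have adjugate_eq : u.1.det • u.1ᴴ = u.1.adjugate := by
    rw [← Matrix.one_mul u.1ᴴ, ← Matrix.smul_mul, ← Matrix.adjugate_mul, Matrix.mul_assoc,
      mul_conjTranspose, Matrix.mul_one]
  rw [adjugate_eq, Matrix.adjugate_fin_two, Matrix.trace_fin_two]
  ext i j
  fin_cases i <;> fin_cases j <;> simp [add_comm]

theorem norm_det_eq_one (u : Matrix.unitaryGroup (Fin 2) ℂ) : ‖u.1.det‖ = 1 :=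
  CStarRing.norm_of_mem_unitary (Matrix.det_of_mem_unitary u.2)

theorem exists_unitary_mul_eq_smul_mul_not {u : Matrix (Fin 2) (Fin 2) ℂ} {z : ℂ}
    {e f : Fin 2 → ℂ} (he : star e ⬝ᵥ e = 1) (hf : star f ⬝ᵥ f = 1) (hef : star e ⬝ᵥ f = 0)
    (hue : u *ᵥ e = z • f) (huf : u *ᵥ f = z • e) :
    ∃ g : Matrix.unitaryGroup (Fin 2) ℂ, u * g.1 = z • (g.1 * !![0, 1; 1, 0]) := by
  let G : Matrix (Fin 2) (Fin 2) ℂ := Matrix.of fun i j => (![e, f] : Fin 2 → Fin 2 → ℂ) j i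
  have hfe : star f ⬝ᵥ e = 0 := by
    rw [Matrix.star_dotProduct, hef, star_zero]
  have G_isometry : Gᴴ * G = 1 := by
    ext i j
    change star ((![e, f] : Fin 2 → Fin 2 → ℂ) i) ⬝ᵥ (![e, f] : Fin 2 → Fin 2 → ℂ) j = _
    fin_cases i <;> fin_cases j
    exacts [he, hef, hfe, hf]
  refine ⟨⟨G, Matrix.mem_unitaryGroup_iff'.2 G_isometry⟩, ?_⟩
  ext i j
  have mulVec_e : u i 0 * e 0 + u i 1 * e 1 = z * f i := by
    simpa only [Matrix.mulVec, dotProduct, Fin.sum_univ_two, Pi.smul_apply, smul_eq_mul]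
      using congrFun hue i
  have mulVec_f : u i 0 * f 0 + u i 1 * f 1 = z * e i := by
    simpa only [Matrix.mulVec, dotProduct, Fin.sum_univ_two, Pi.smul_apply, smul_eq_mul]
      using congrFun huf i
  fin_cases j <;> simpa [Matrix.mul_apply, G]

theorem exists_eq_smul_conj_not_of_trace_eq_zero {u : Matrix.unitaryGroup (Fin 2) ℂ}
    (hu : u.1.trace = 0) :
    ∃ (z : ℂ) (g : Matrix.unitaryGroup (Fin 2) ℂ),
      ‖z‖ = 1 ∧ u.1 = z • (g.1 * !![0, 1; 1, 0] * g.1ᴴ) := by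
  obtain ⟨e, unit, orthogonal⟩ := exists_unit_orthogonal_mulVec_of_trace_eq_zero hu
  obtain ⟨z, hz⟩ := IsAlgClosed.exists_pow_nat_eq (-u.1.det) two_pos
  have norm_z : ‖z‖ = 1 := by
    rw [← pow_eq_one_iff_of_nonneg (norm_nonneg z) two_ne_zero, ← norm_pow, hz, norm_neg,
      norm_det_eq_one]
  have z_ne_zero : z ≠ 0 := norm_ne_zero_iff.1 (norm_z.trans_ne one_ne_zero)
  have phase : starRingEnd ℂ z * z = 1 := by
    rw [Complex.conj_mul', norm_z, Complex.ofReal_one, one_pow]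
  have u_isometry : u.1ᴴ * u.1 = 1 := Unitary.coe_star_mul_self u
  have u_sq : u.1 * u.1 = z ^ 2 • 1 := by
    have := add_det_smul_conjTranspose u
    rw [hu, zero_smul, add_eq_zero_iff_eq_neg, ← neg_smul, ← hz] at this
    nth_rw 1 [this]
    rw [Matrix.smul_mul, u_isometry]
  obtain ⟨g, hg⟩ := exists_unitary_mul_eq_smul_mul_not (f := z⁻¹ • (u.1 *ᵥ e)) unit
    (by rw [star_smul, smul_dotProduct, dotProduct_smul, smul_smul, Matrix.star_mulVec,
      Matrix.dotProduct_mulVec, Matrix.vecMul_vecMul, u_isometry, Matrix.vecMul_one, unit,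
      star_inv₀, ← mul_inv, Complex.star_def, phase, inv_one, one_smul])
    (by rw [dotProduct_smul, orthogonal, smul_zero])
    (by rw [smul_smul, mul_inv_cancel₀ z_ne_zero, one_smul])
    (by rw [Matrix.mulVec_smul, Matrix.mulVec_mulVec, u_sq, Matrix.smul_mulVec, Matrix.one_mulVec,
      smul_smul, pow_two, inv_mul_cancel_left₀ z_ne_zero])
  refine ⟨z, g, norm_z, ?_⟩
  rw [← Matrix.smul_mul, ← hg, Matrix.mul_assoc, ← Matrix.star_eq_conjTranspose,
    Unitary.mul_star_self_of_mem g.2, Matrix.mul_one]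

theorem controlled_locallyEquivalent_cnot_of_trace_eq_zero {u : Matrix.unitaryGroup (Fin 2) ℂ}
    (hu : u.1.trace = 0) : LocallyEquivalent (controlled u.1) cnot := by
  obtain ⟨z, g, norm_z, hg⟩ := exists_eq_smul_conj_not_of_trace_eq_zero hu
  have g_mul_star : g.1 * g.1ᴴ = 1 := Unitary.coe_mul_star_self g
  let d : Matrix.unitaryGroup (Fin 2) ℂ :=
    diagonalGate ![1, z] (by simp [Fin.forall_fin_two, norm_z])
  have d_mul_zero : d.1 * Matrix.single 0 0 1 = Matrix.single 0 0 1 := by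
    ext i j
    fin_cases i <;> fin_cases j <;> simp [d, diagonalGate]
  have d_mul_one : d.1 * Matrix.single 1 1 1 = z • Matrix.single 1 1 1 := by
    ext i j
    fin_cases i <;> fin_cases j <;> simp [d, diagonalGate]
  refine ⟨d, g, 1, star g, ?_⟩
  simp only [controlled, cnot, hg, Matrix.mul_add, Matrix.add_mul, ← Matrix.mul_kronecker_mul,
    d_mul_zero, d_mul_one, Submonoid.coe_one, Matrix.mul_one, Unitary.coe_star,
    Matrix.star_eq_conjTranspose, g_mul_star, Matrix.smul_kronecker, Matrix.kronecker_smul,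
    Matrix.smul_mul]

variable {v w : Matrix.unitaryGroup (Fin 2) ℂ} {G : Fin 2 → Matrix.unitaryGroup (Fin 2) ℂ}

theorem multiplexer_locallyEquivalent_cnot (hG : ((G 0).1ᴴ * (G 1).1).trace = 0) :
    LocallyEquivalent (multiplexer v w G) cnot :=
  multiplexer_locallyEquivalent_controlled.trans
    (controlled_locallyEquivalent_cnot_of_trace_eq_zero (u := star (G 0) * G 1) hG)

theorem exists_eq_multiplexer_of_locallyEquivalent_cnot {U : TwoQubitOp}
    (hU : LocallyEquivalent U cnot) :
    ∃ v w G, U = multiplexer v w G ∧ ((G 0).1ᴴ * (G 1).1).trace = 0 := by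
  obtain ⟨v₁, v₂, w₁, w₂, rfl⟩ := hU
  have flip_mem : !![(0 : ℂ), 1; 1, 0] ∈ Matrix.unitaryGroup (Fin 2) ℂ := by
    rw [Matrix.mem_unitaryGroup_iff]
    ext i j
    fin_cases i <;> fin_cases j <;> simp [Matrix.mul_apply]
  refine ⟨v₁, w₁, _, kronecker_mul_controlled_mul_kronecker ⟨_, flip_mem⟩ v₁ v₂ w₁ w₂, ?_⟩
  have v₂_isometry : v₂.1ᴴ * v₂.1 = 1 := Unitary.coe_star_mul_self v₂
  have w₂_coisometry : w₂.1 * w₂.1ᴴ = 1 := Unitary.coe_mul_star_self w₂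
  calc ((v₂.1 * w₂.1)ᴴ * (v₂.1 * !![(0 : ℂ), 1; 1, 0] * w₂.1)).trace
      = (w₂.1ᴴ * ((v₂.1ᴴ * v₂.1) * !![0, 1; 1, 0] * w₂.1)).trace := by
        simp only [Matrix.conjTranspose_mul, Matrix.mul_assoc]
    _ = 0 := by
        rw [Matrix.trace_mul_comm, v₂_isometry, Matrix.one_mul, Matrix.mul_assoc, w₂_coisometry,
          Matrix.mul_one, Matrix.trace_fin_two_of, add_zero]

end ControlledNot

section Completion

variable {a b c d k l : ℕ}

/-- Completion of a measurement for which `∑ r, (T r)ᴴ * T r` is a projection: the additional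
outcomes `|0⟩⟨i|` act on the orthogonal complement of its range. -/
def completion [NeZero c] (T : Fin k → Matrix (Fin c) (Fin a) ℂ) :
    Fin (k + a) → Matrix (Fin c) (Fin a) ℂ :=
  Fin.append T fun i => Matrix.single (0 : Fin c) i (1 : ℂ) * (1 - ∑ r, (T r)ᴴ * T r)

theorem sum_conjTranspose_mul_completion [NeZero c] {T : Fin k → Matrix (Fin c) (Fin a) ℂ}
    (hT : IsIdempotentElem (∑ r, (T r)ᴴ * T r)) :
    ∑ r, (completion T r)ᴴ * completion T r = 1 := by
  simp only [completion, Fin.sum_univ_add, Fin.append_left, Fin.append_right]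
  set p := ∑ r, (T r)ᴴ * T r with hp
  have p_conjTranspose : (1 - p)ᴴ = 1 - p := by
    simp [hp, Matrix.conjTranspose_sum, Matrix.conjTranspose_mul]
  have outcome : ∀ i, (Matrix.single (0 : Fin c) i (1 : ℂ) * (1 - p))ᴴ *
      (Matrix.single (0 : Fin c) i (1 : ℂ) * (1 - p)) =
        (1 - p) * (Matrix.single i i (1 : ℂ) * (1 - p)) := fun i => by
    rw [Matrix.conjTranspose_mul, p_conjTranspose, Matrix.conjTranspose_single, Matrix.mul_assoc,
      ← Matrix.mul_assoc (Matrix.single i _ _), Matrix.single_mul_single_same, star_one, mul_one]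
  simp_rw [outcome]
  rw [← Matrix.mul_sum, ← Matrix.sum_mul, Matrix.sum_single_one, Matrix.one_mul, hT.one_sub.eq,
    add_sub_cancel]

theorem mul_one_sub_kronecker_mul_eq_zero {κ : Type*} {p : Matrix (Fin a) (Fin a) ℂ}
    {J : Matrix (Fin a × Fin b) κ ℂ} (hJ : (p ⊗ₖ (1 : Matrix (Fin b) (Fin b) ℂ)) * J = J)
    (A : Matrix (Fin c) (Fin a) ℂ) (B : Matrix (Fin d) (Fin b) ℂ) :
    ((A * (1 - p)) ⊗ₖ B) * J = 0 := by
  have split : ((A * (1 - p)) ⊗ₖ B) * J +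
      (A ⊗ₖ B) * ((p ⊗ₖ (1 : Matrix (Fin b) (Fin b) ℂ)) * J) = (A ⊗ₖ B) * J := by
    rw [← Matrix.mul_assoc, ← Matrix.mul_kronecker_mul, Matrix.mul_one, ← Matrix.add_mul,
      ← Matrix.add_kronecker, ← Matrix.mul_add, sub_add_cancel, Matrix.mul_one]
  rwa [hJ, add_eq_right] at split

theorem kronecker_mul_one_sub_mul_eq_zero {κ : Type*} {p : Matrix (Fin b) (Fin b) ℂ}
    {J : Matrix (Fin a × Fin b) κ ℂ} (hJ : ((1 : Matrix (Fin a) (Fin a) ℂ) ⊗ₖ p) * J = J)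
    (A : Matrix (Fin c) (Fin a) ℂ) (B : Matrix (Fin d) (Fin b) ℂ) :
    (A ⊗ₖ (B * (1 - p))) * J = 0 := by
  have split : (A ⊗ₖ (B * (1 - p))) * J +
      (A ⊗ₖ B) * (((1 : Matrix (Fin a) (Fin a) ℂ) ⊗ₖ p) * J) = (A ⊗ₖ B) * J := by
    rw [← Matrix.mul_assoc, ← Matrix.mul_kronecker_mul, Matrix.mul_one, ← Matrix.add_mul,
      ← Matrix.kronecker_add, ← Matrix.mul_add, sub_add_cancel, Matrix.mul_one]
  rwa [hJ, add_eq_right] at split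

/-- The protocol in which Alice measures `M`, Bob measures `K r` after Alice's outcome `r`, and
Alice applies `V t` after Bob's outcome `t`. -/
def threeTurnProtocol (M : Fin k → Matrix (Fin c) (Fin a) ℂ) (hM : ∑ r, (M r)ᴴ * M r = 1)
    (K : Fin k → Fin l → Matrix (Fin d) (Fin b) ℂ) (hK : ∀ r, ∑ t, (K r t)ᴴ * K r t = 1)
    (V : Fin l → Matrix.unitaryGroup (Fin c) ℂ) : LOCC c d a b :=
  .alice k (fun _ => c) M hM fun r =>
    .bob l (fun _ => d) (K r) (hK r) fun t =>
      .alice 1 (fun _ => c) (fun _ => (V t).1)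
        (by rw [Fin.sum_univ_one]; exact Unitary.coe_star_mul_self (V t)) fun _ => .done

variable {M : Fin k → Matrix (Fin c) (Fin a) ℂ} {hM : ∑ r, (M r)ᴴ * M r = 1}
  {K : Fin k → Fin l → Matrix (Fin d) (Fin b) ℂ} {hK : ∀ r, ∑ t, (K r t)ᴴ * K r t = 1}
  {V : Fin l → Matrix.unitaryGroup (Fin c) ℂ}

theorem threeTurnProtocol_turns [NeZero k] [NeZero l] :
    (threeTurnProtocol M hM K hK V).turns = 3 := by
  simp [threeTurnProtocol, LOCC.turns, Finset.sup_const Finset.univ_nonempty]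

theorem threeTurnProtocol_channel (ρ : Matrix (Fin a × Fin b) (Fin a × Fin b) ℂ) :
    (threeTurnProtocol M hM K hK V).channel ρ =
      ∑ r, ∑ t, (((V t).1 * M r) ⊗ₖ K r t) * ρ * (((V t).1 * M r) ⊗ₖ K r t)ᴴ := by
  have factor : ∀ r t, ((V t).1 * M r) ⊗ₖ K r t =
      ((V t).1 ⊗ₖ (1 : Matrix (Fin d) (Fin d) ℂ)) *
        (((1 : Matrix (Fin c) (Fin c) ℂ) ⊗ₖ K r t) *
          (M r ⊗ₖ (1 : Matrix (Fin b) (Fin b) ℂ))) := fun r t => by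
    simp only [← Matrix.mul_kronecker_mul, Matrix.one_mul, Matrix.mul_one]
  simp only [threeTurnProtocol, LOCC.channel, Fin.sum_univ_one, factor, Matrix.conjTranspose_mul,
    Matrix.mul_assoc]

/-- The measurements only have to be complete on the local supports of the states in question. -/
theorem exists_three_turn_protocol [NeZero c] [NeZero d] [NeZero k] [NeZero l] {κ : Type*}
    [Fintype κ] {J : Matrix (Fin a × Fin b) κ ℂ} {T : Fin k → Matrix (Fin c) (Fin a) ℂ}
    {S : Fin k → Fin l → Matrix (Fin d) (Fin b) ℂ}
    (hT : IsIdempotentElem (∑ r, (T r)ᴴ * T r))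
    (hTJ : ((∑ r, (T r)ᴴ * T r) ⊗ₖ (1 : Matrix (Fin b) (Fin b) ℂ)) * J = J)
    (hS : ∀ r, IsIdempotentElem (∑ t, (S r t)ᴴ * S r t))
    (hSJ : ∀ r, ((1 : Matrix (Fin a) (Fin a) ℂ) ⊗ₖ (∑ t, (S r t)ᴴ * S r t)) * J = J)
    (V : Fin l → Matrix.unitaryGroup (Fin c) ℂ) :
    ∃ P : LOCC c d a b, P.turns = 3 ∧ ∀ ρ : Matrix κ κ ℂ, P.channel (J * ρ * Jᴴ) =
      ∑ r, ∑ t, ((((V t).1 * T r) ⊗ₖ S r t) * J) * ρ *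
        ((((V t).1 * T r) ⊗ₖ S r t) * J)ᴴ := by
  let S' : Fin (k + a) → Fin l → Matrix (Fin d) (Fin b) ℂ := Fin.append S 0
  have hS' : ∀ r, IsIdempotentElem (∑ t, (S' r t)ᴴ * S' r t) :=
    Fin.addCases (fun r => by simpa only [S', Fin.append_left] using hS r)
      (fun r => by simp [S', IsIdempotentElem])
  have : NeZero (k + a) := ⟨by simp [NeZero.ne k]⟩
  have : NeZero (l + b) := ⟨by simp [NeZero.ne l]⟩
  refine ⟨threeTurnProtocol (completion T) (sum_conjTranspose_mul_completion hT)
    (fun r => completion (S' r)) (fun r => sum_conjTranspose_mul_completion (hS' r))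
    (Fin.append V 1), threeTurnProtocol_turns, fun ρ => ?_⟩
  have regroup : ∀ X : Matrix (Fin c × Fin d) (Fin a × Fin b) ℂ,
      X * (J * ρ * Jᴴ) * Xᴴ = (X * J) * ρ * (X * J)ᴴ := fun X => by
    simp only [Matrix.conjTranspose_mul, Matrix.mul_assoc]
  have alice_completion : ∀ (W : Matrix (Fin c) (Fin c) ℂ) (i : Fin a)
      (N : Matrix (Fin d) (Fin b) ℂ), ((W * completion T (Fin.natAdd k i)) ⊗ₖ N) * J = 0 :=
    fun W i N => by
      rw [completion, Fin.append_right, ← Matrix.mul_assoc, mul_one_sub_kronecker_mul_eq_zero hTJ]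
  have bob_completion : ∀ (N : Matrix (Fin c) (Fin a) ℂ) (r : Fin k) (i : Fin b),
      (N ⊗ₖ completion (S r) (Fin.natAdd l i)) * J = 0 := fun N r i => by
    rw [completion, Fin.append_right, kronecker_mul_one_sub_mul_eq_zero (hSJ r)]
  rw [threeTurnProtocol_channel]
  simp only [regroup, Fin.sum_univ_add, alice_completion, S', Fin.append_left, bob_completion,
    Matrix.zero_mul, Finset.sum_const_zero, add_zero]
  simp only [completion, Fin.append_left]

end Completion

section Protocol

/-- The entry `(-1) ^ (t * a)` of the character table of `ℤ/2ℤ`. -/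
def paritySign (t a : Fin 2) : ℂ := (-1) ^ (t.val * a.val)

theorem norm_paritySign (t a : Fin 2) : ‖paritySign t a‖ = 1 := by simp [paritySign]

theorem paritySign_mul_self (t a : Fin 2) : paritySign t a * paritySign t a = 1 := by
  rw [paritySign, ← mul_pow, neg_one_mul, neg_neg, one_pow]

theorem star_paritySign (t a : Fin 2) : star (paritySign t a) = paritySign t a := by
  simp [paritySign]

theorem sum_paritySign_mul_paritySign (a b : Fin 2) :
    ∑ t, paritySign t a * paritySign t b = if a = b then 2 else 0 := by
  fin_cases a <;> fin_cases b <;> norm_num [paritySign, Fin.sum_univ_two]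

section IsOrthogonalIsometries

variable {c x σ : Type*} [Fintype c] [DecidableEq c] [Fintype x] [DecidableEq σ]
  {P : σ → Matrix x c ℂ}

theorem IsOrthogonalIsometries.mul_conjTranspose_mul {y : Type*} (hP : IsOrthogonalIsometries P)
    (M : Matrix y c ℂ) (i j : σ) : M * (P i)ᴴ * P j = if i = j then M else 0 := by
  rw [Matrix.mul_assoc, hP]
  split_ifs <;> simp

theorem IsOrthogonalIsometries.sum_mul_conjTranspose_mul [Fintype σ]
    (hP : IsOrthogonalIsometries P) (j : σ) : (∑ i, P i * (P i)ᴴ) * P j = P j := by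
  simp [Matrix.sum_mul, hP.mul_conjTranspose_mul]

theorem IsOrthogonalIsometries.isIdempotentElem [Fintype σ] (hP : IsOrthogonalIsometries P) :
    IsIdempotentElem (∑ i, P i * (P i)ᴴ) := by
  simp only [IsIdempotentElem, Matrix.mul_sum, ← Matrix.mul_assoc, hP.sum_mul_conjTranspose_mul]

end IsOrthogonalIsometries

variable {x y : Type*} {A : Fin 2 → Matrix x (Fin 2) ℂ}
  {B : Fin 2 → Matrix y (Fin 2) ℂ} {v w : Matrix.unitaryGroup (Fin 2) ℂ}
  {G : Fin 2 → Matrix.unitaryGroup (Fin 2) ℂ} {s : ℂ}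

/-- Alice's measurement: she applies `w` to her input qubit, measures the parity `r` of the qubit
and her half of the resource, whose state `o` is encoded by the isometry `A o`, and discards that
half. -/
def parityMeasurement (A : Fin 2 → Matrix x (Fin 2) ℂ) (w : Matrix.unitaryGroup (Fin 2) ℂ)
    (r : Fin 2) : Matrix (Fin 2) x ℂ :=
  ∑ a, Matrix.single a a 1 * w.1 * (A (a + r))ᴴ

/-- Bob's measurement after Alice's outcome `r`: his half of the resource, whose state `o` is
encoded by the isometry `B o`, now carries Alice's control bit `a = o - r`; he applies `G a` to his
input qubit and measures that half in the Hadamard basis, with outcome `t`. The normalization `s`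
is that of the resource `∑ o, s • |oo⟩`. -/
def controlMeasurement (B : Fin 2 → Matrix y (Fin 2) ℂ)
    (G : Fin 2 → Matrix.unitaryGroup (Fin 2) ℂ) (s : ℂ) (r t : Fin 2) : Matrix (Fin 2) y ℂ :=
  ∑ a, (star s * paritySign t a) • ((G a).1 * (B (a + r))ᴴ)

/-- Alice's final gate after Bob's outcome `t`, which removes the phases `paritySign t`. -/
def phaseCorrection (v : Matrix.unitaryGroup (Fin 2) ℂ) (t : Fin 2) :
    Matrix.unitaryGroup (Fin 2) ℂ :=
  v * diagonalGate (paritySign t) (norm_paritySign t)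

theorem parityMeasurement_mul [Fintype x] (hA : IsOrthogonalIsometries A) (r a : Fin 2) :
    parityMeasurement A w r * A (a + r) = Matrix.single a a 1 * w.1 := by
  simp only [parityMeasurement, Matrix.sum_mul, hA.mul_conjTranspose_mul, add_left_inj,
    Finset.sum_ite_eq', Finset.mem_univ, if_true]

theorem controlMeasurement_mul [Fintype y] (hB : IsOrthogonalIsometries B) (r t a : Fin 2) :
    controlMeasurement B G s r t * B (a + r) = (star s * paritySign t a) • (G a).1 := by
  simp only [controlMeasurement, Matrix.sum_mul, Matrix.smul_mul, hB.mul_conjTranspose_mul,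
    add_left_inj, smul_ite, smul_zero, Finset.sum_ite_eq', Finset.mem_univ, if_true]

theorem phaseCorrection_mul_single (t a : Fin 2) :
    (phaseCorrection v t).1 * Matrix.single a a 1 =
      paritySign t a • (v.1 * Matrix.single a a 1) := by
  have : (Matrix.diagonal (paritySign t) : Matrix (Fin 2) (Fin 2) ℂ) * Matrix.single a a 1 =
      paritySign t a • Matrix.single a a 1 := by
    ext i j
    by_cases h : a = i <;> simp [Matrix.diagonal_mul, Matrix.single_apply, h]
  rw [phaseCorrection, Submonoid.coe_mul, Matrix.mul_assoc, diagonalGate, this, Matrix.mul_smul]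

theorem sum_parityMeasurement_conjTranspose_mul :
    ∑ r, (parityMeasurement A w r)ᴴ * parityMeasurement A w r = ∑ o, A o * (A o)ᴴ := by
  have hw : w.1ᴴ * w.1 = 1 := Unitary.coe_star_mul_self w
  have cross : ∀ (a b : Fin 2) (Y Z : Matrix (Fin 2) x ℂ),
      (Matrix.single a a (1 : ℂ) * Y)ᴴ * (Matrix.single b b (1 : ℂ) * Z) =
        if a = b then Yᴴ * Matrix.single a a (1 : ℂ) * Z else 0 := fun a b Y Z => by
    rw [Matrix.conjTranspose_mul, Matrix.conjTranspose_single, star_one, Matrix.mul_assoc,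
      ← Matrix.mul_assoc (Matrix.single a a (1 : ℂ))]
    rcases eq_or_ne a b with rfl | hab
    · simp [Matrix.mul_assoc]
    · simp [hab]
  have term : ∀ r, (parityMeasurement A w r)ᴴ * parityMeasurement A w r =
      ∑ a, A (a + r) * (w.1ᴴ * Matrix.single a a 1 * w.1) * (A (a + r))ᴴ := fun r => by
    simp only [parityMeasurement, Matrix.conjTranspose_sum, Matrix.sum_mul, Matrix.mul_sum,
      Matrix.mul_assoc (Matrix.single _ _ _), cross, Finset.sum_ite_eq', Finset.mem_univ, if_true]
    simp only [Matrix.conjTranspose_mul, Matrix.conjTranspose_conjTranspose, Matrix.mul_assoc]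
  calc ∑ r, (parityMeasurement A w r)ᴴ * parityMeasurement A w r
      = ∑ a, ∑ o, A o * (w.1ᴴ * Matrix.single a a 1 * w.1) * (A o)ᴴ := by
        simp only [term]
        rw [Finset.sum_comm]
        exact Finset.sum_congr rfl fun a _ => Equiv.sum_comp (Equiv.addLeft a) fun o =>
          A o * (w.1ᴴ * Matrix.single a a 1 * w.1) * (A o)ᴴ
    _ = ∑ o, A o * (w.1ᴴ * (∑ a, Matrix.single a a 1) * w.1) * (A o)ᴴ := by
        rw [Finset.sum_comm]
        simp only [Matrix.mul_sum, Matrix.sum_mul]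
    _ = ∑ o, A o * (A o)ᴴ := by
        rw [Matrix.sum_single_one, Matrix.mul_one, hw]
        simp only [Matrix.mul_one]

theorem sum_controlMeasurement_conjTranspose_mul (hs : star s * s = 2⁻¹) (r : Fin 2) :
    ∑ t, (controlMeasurement B G s r t)ᴴ * controlMeasurement B G s r t = ∑ o, B o * (B o)ᴴ := by
  have hG : ∀ a, (G a).1ᴴ * (G a).1 = 1 := fun a => Unitary.coe_star_mul_self (G a)
  have term : ∀ t, (controlMeasurement B G s r t)ᴴ * controlMeasurement B G s r t =
      ∑ a, ∑ b, (2⁻¹ * (paritySign t a * paritySign t b)) •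
        (B (a + r) * ((G a).1ᴴ * (G b).1) * (B (b + r))ᴴ) := fun t => by
    simp only [controlMeasurement, Matrix.conjTranspose_sum, Matrix.sum_mul, Matrix.mul_sum]
    rw [Finset.sum_comm]
    refine Finset.sum_congr rfl fun a _ => Finset.sum_congr rfl fun b _ => ?_
    simp only [Matrix.conjTranspose_smul, Matrix.conjTranspose_mul, star_mul, star_star,
      Matrix.conjTranspose_conjTranspose, star_paritySign, Matrix.smul_mul, Matrix.mul_smul,
      smul_smul, Matrix.mul_assoc]
    congr 1
    linear_combination paritySign t a * paritySign t b * hs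
  calc ∑ t, (controlMeasurement B G s r t)ᴴ * controlMeasurement B G s r t
      = ∑ a, ∑ b, (2⁻¹ * ∑ t, paritySign t a * paritySign t b) •
          (B (a + r) * ((G a).1ᴴ * (G b).1) * (B (b + r))ᴴ) := by
        simp only [term, Finset.mul_sum, Finset.sum_smul]
        rw [Finset.sum_comm]
        exact Finset.sum_congr rfl fun a _ => Finset.sum_comm
    _ = ∑ a, B (a + r) * (B (a + r))ᴴ := by
        simp only [sum_paritySign_mul_paritySign, mul_ite, ite_smul, mul_zero, zero_smul,
          Finset.sum_ite_eq, Finset.mem_univ, if_true, hG, Matrix.mul_one]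
        norm_num
    _ = ∑ o, B o * (B o)ᴴ :=
        Equiv.sum_comp (Equiv.addRight r) fun o => B o * (B o)ᴴ

theorem phaseCorrection_mul_parityMeasurement_kronecker_mul [Fintype x] [Fintype y]
    (hA : IsOrthogonalIsometries A) (hB : IsOrthogonalIsometries B) (hs : star s * s = 2⁻¹)
    (r t : Fin 2) :
    (((phaseCorrection v t).1 * parityMeasurement A w r) ⊗ₖ controlMeasurement B G s r t) *
      ∑ o, s • (A o ⊗ₖ B o) = (2⁻¹ : ℂ) • multiplexer v w G := by
  rw [← Equiv.sum_comp (Equiv.addRight r), multiplexer, Matrix.mul_sum, Finset.smul_sum]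
  refine Finset.sum_congr rfl fun a _ => ?_
  rw [Equiv.coe_addRight, Matrix.mul_smul, ← Matrix.mul_kronecker_mul, Matrix.mul_assoc,
    parityMeasurement_mul hA, controlMeasurement_mul hB, ← Matrix.mul_assoc,
    phaseCorrection_mul_single, Matrix.smul_mul, Matrix.smul_kronecker, Matrix.kronecker_smul,
    smul_smul, smul_smul, ← hs]
  congr 1
  linear_combination s * star s * paritySign_mul_self t a

end Protocol

section MaximallyEntangledResource

variable {m n : ℕ} {ψ : Fin m × Fin n → ℂ}

theorem IsMaximallyEntangled.exists_schmidt_decomposition {k : ℕ} (hmax : IsMaximallyEntangled ψ)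
    (hψ : IsPureState ψ) (hk : schmidtNumber ψ = k) :
    ∃ (s : ℂ) (p : Fin k → Fin m → ℂ) (q : Fin k → Fin n → ℂ), star s * s = (k : ℂ)⁻¹ ∧
      (∀ i j, star (p i) ⬝ᵥ p j = if i = j then 1 else 0) ∧
      (∀ i j, star (q i) ⬝ᵥ q j = if i = j then 1 else 0) ∧
      ∀ x, ψ x = ∑ o, s * (p o x.1 * q o x.2) := by
  obtain ⟨p, q, hp, hq, decomposition⟩ := LOCCCost.exists_schmidt_decomposition ψ
  have coeff_eq : ∀ i : SchmidtIndex ψ, schmidtCoeff ψ i = Real.sqrt (k : ℝ)⁻¹ := fun i => by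
    rw [← hk, ← hmax.schmidtCoeff_sq_eq hψ i.2, Real.sqrt_sq]
    exact Real.sqrt_nonneg _
  let e : Fin k ≃ SchmidtIndex ψ :=
    (Fintype.equivFinOfCardEq ((card_schmidtIndex ψ).trans hk)).symm
  refine ⟨Real.sqrt (k : ℝ)⁻¹, fun o => p (e o), fun o => q (e o), ?_, fun i j => ?_,
    fun i j => ?_, fun x => ?_⟩
  · rw [Complex.star_def, Complex.conj_ofReal, ← Complex.ofReal_mul,
      Real.mul_self_sqrt (by positivity), Complex.ofReal_inv, Complex.ofReal_natCast]
  · simp only [hp, e.injective.eq_iff]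
  · simp only [hq, e.injective.eq_iff]
  · simp only [decomposition x, coeff_eq]
    exact (e.sum_comp fun i => ((Real.sqrt (k : ℝ)⁻¹ : ℝ) : ℂ) * (p i x.1 * q i x.2)).symm

theorem IsMaximallyEntangled.exists_implements_multiplexer (hmax : IsMaximallyEntangled ψ)
    (hψ : IsPureState ψ) (hk : schmidtNumber ψ = 2) (v w : Matrix.unitaryGroup (Fin 2) ℂ)
    (G : Fin 2 → Matrix.unitaryGroup (Fin 2) ℂ) :
    ∃ P : LOCC 2 2 (2 * m) (2 * n), P.turns = 3 ∧ Implements P ψ (multiplexer v w G) := by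
  obtain ⟨s, p, q, hs, hp, hq, decomposition⟩ := hmax.exists_schmidt_decomposition hψ hk
  rw [Nat.cast_ofNat] at hs
  have hA := isOrthogonalIsometries_adjoinAncilla 2 hp
  have hB := isOrthogonalIsometries_adjoinAncilla 2 hq
  have hJ := adjoinResource_eq_sum decomposition
  obtain ⟨P, turns_eq, channel_eq⟩ := exists_three_turn_protocol (J := adjoinResource ψ)
    (T := parityMeasurement (fun o => adjoinAncilla 2 (p o)) w)
    (S := controlMeasurement (fun o => adjoinAncilla 2 (q o)) G s)
    (by rw [sum_parityMeasurement_conjTranspose_mul]; exact hA.isIdempotentElem)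
    (by
      simp only [sum_parityMeasurement_conjTranspose_mul, hJ, Matrix.mul_sum, Matrix.mul_smul,
        ← Matrix.mul_kronecker_mul, hA.sum_mul_conjTranspose_mul, Matrix.one_mul])
    (fun r => by rw [sum_controlMeasurement_conjTranspose_mul hs]; exact hB.isIdempotentElem)
    (fun r => by
      simp only [sum_controlMeasurement_conjTranspose_mul hs, hJ, Matrix.mul_sum, Matrix.mul_smul,
        ← Matrix.mul_kronecker_mul, hB.sum_mul_conjTranspose_mul, Matrix.one_mul])
    (phaseCorrection v)
  refine ⟨P, turns_eq, fun ρ _ => ?_⟩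
  rw [jointState_eq_adjoinResource, channel_eq]
  simp only [hJ, phaseCorrection_mul_parityMeasurement_kronecker_mul hA hB hs]
  simp only [Finset.sum_const, Finset.card_univ, Fintype.card_fin, Matrix.conjTranspose_smul,
    Matrix.smul_mul, Matrix.mul_smul, smul_smul, ← Nat.cast_smul_eq_nsmul ℂ]
  norm_num

end MaximallyEntangledResource

section BinarySpectrum

theorem exists_sum_eq_add_of_card_support_le_two {ι : Type*} [Fintype ι] {p : ι → ℝ}
    (nonneg : ∀ i, 0 ≤ p i) (sum_eq : ∑ i, p i = 1) (card_le : Fintype.card {i // p i ≠ 0} ≤ 2) :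
    ∃ t ∈ Set.Icc (0 : ℝ) 1, ∀ f : ℝ → ℝ, f 0 = 0 → ∑ i, f (p i) = f t + f (1 - t) := by
  classical
  rw [Fintype.card_subtype] at card_le
  have sum_support : ∀ f : ℝ → ℝ, f 0 = 0 → ∑ i with p i ≠ 0, f (p i) = ∑ i, f (p i) :=
    fun f hf => Finset.sum_subset (Finset.subset_univ _) fun i _ hi => by
      rw [show p i = 0 by simpa using hi, hf]
  have sum_eq' := (sum_support id rfl).trans sum_eq
  obtain h | h | h : Finset.card {i | p i ≠ 0} = 0 ∨ Finset.card {i | p i ≠ 0} = 1 ∨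
      Finset.card {i | p i ≠ 0} = 2 := by lia
  · rw [Finset.card_eq_zero.1 h, Finset.sum_empty] at sum_eq'
    exact absurd sum_eq' zero_ne_one
  · obtain ⟨i, hi⟩ := Finset.card_eq_one.1 h
    rw [hi, Finset.sum_singleton, id] at sum_eq'
    refine ⟨1, Set.right_mem_Icc.2 zero_le_one, fun f hf => ?_⟩
    rw [← sum_support f hf, hi, Finset.sum_singleton, sum_eq', sub_self, hf, add_zero]
  · obtain ⟨i, j, hij, hi⟩ := Finset.card_eq_two.1 h
    rw [hi, Finset.sum_pair hij, id, id] at sum_eq'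
    refine ⟨p i, ⟨nonneg i, by linarith [nonneg j]⟩, fun f hf => ?_⟩
    rw [← sum_support f hf, hi, Finset.sum_pair hij, ← sum_eq', add_sub_cancel_left]

variable {A B : Type*} [Fintype A] [DecidableEq A] [Fintype B] {ψ : A × B → ℂ}

theorem schmidtNumber_eq_rank : schmidtNumber ψ = (coeffMatrix ψ).rank := by
  rw [← Matrix.rank_self_mul_conjTranspose, ← reduced,
    (reduced_isHermitian ψ).rank_eq_card_non_zero_eigs, ← card_schmidtIndex]
  simp only [← schmidtCoeff_sq, ne_eq, pow_eq_zero_iff two_ne_zero]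

theorem trace_reduced_mul_reduced :
    (reduced ψ * reduced ψ).trace = ((∑ i, (schmidtCoeff ψ i ^ 2) ^ 2 : ℝ) : ℂ) := by
  have hR := reduced_isHermitian ψ
  conv_lhs => rw [hR.spectral_theorem, ← map_mul, Unitary.conjStarAlgAut_apply,
    Matrix.trace_mul_cycle, Unitary.coe_star_mul_self, Matrix.one_mul,
    Matrix.diagonal_mul_diagonal, Matrix.trace_diagonal]
  simp only [schmidtCoeff_sq]
  simp only [pow_two, Function.comp_apply, Complex.coe_algebraMap, Complex.ofReal_sum,
    Complex.ofReal_mul]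

theorem exists_entanglement_eq_binEntropy (hψ : IsPureState ψ) (hk : schmidtNumber ψ ≤ 2) :
    ∃ t ∈ Set.Icc (0 : ℝ) 1, entanglement ψ = Real.binEntropy t / Real.log 2 ∧
      (reduced ψ * reduced ψ).trace = ((t ^ 2 + (1 - t) ^ 2 : ℝ) : ℂ) := by
  obtain ⟨t, ht, sum_eq⟩ := exists_sum_eq_add_of_card_support_le_two
    (fun i => sq_nonneg (schmidtCoeff ψ i)) (sum_schmidtCoeff_sq hψ)
    (by simpa only [ne_eq, pow_eq_zero_iff two_ne_zero, ← card_schmidtIndex] using hk)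
  refine ⟨t, ht, ?_, ?_⟩
  · rw [Real.binEntropy_eq_negMulLog_add_negMulLog_one_sub, ← sum_eq _ Real.negMulLog_zero,
      entanglement, Finset.sum_div, ← Finset.sum_neg_distrib]
    refine Finset.sum_congr rfl fun i _ => ?_
    rw [Real.negMulLog, Real.logb, neg_mul, neg_div, mul_div_assoc]
  · rw [trace_reduced_mul_reduced, sum_eq (· ^ 2) (zero_pow two_ne_zero)]

end BinarySpectrum

section OrthogonalExpansion

theorem star_dotProduct_self {ι : Type*} [Fintype ι] (x : ι → ℂ) :
    star x ⬝ᵥ x = ((∑ i, ‖x i‖ ^ 2 : ℝ) : ℂ) := by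
  simp only [dotProduct, Pi.star_apply, Complex.star_def, Complex.conj_mul', Complex.ofReal_sum,
    Complex.ofReal_pow]

theorem norm_star_dotProduct_le_one {ι : Type*} [Fintype ι] {x y : ι → ℂ} (hx : IsPureState x)
    (hy : IsPureState y) : ‖star x ⬝ᵥ y‖ ≤ 1 := by
  have norm_eq_one : ∀ {z : ι → ℂ}, IsPureState z → ‖WithLp.toLp 2 z‖ = 1 := fun hz => by
    rw [EuclideanSpace.norm_eq, Real.sqrt_eq_one]
    exact hz
  have := norm_inner_le_norm (𝕜 := ℂ) (WithLp.toLp 2 x) (WithLp.toLp 2 y)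
  rwa [EuclideanSpace.inner_toLp_toLp, dotProduct_comm, norm_eq_one hx, norm_eq_one hy,
    mul_one] at this

variable {A B κ : Type*} [Fintype A] [Fintype B] {ψ : A × B → ℂ} {x : κ → A → ℂ}
  {y : κ → B → ℂ}

theorem conjTranspose_mul_self_of_orthogonal [DecidableEq κ] {g : κ → ℝ}
    (hx : ∀ a b, star (x a) ⬝ᵥ x b = if a = b then (g a : ℂ) else 0) :
    (Matrix.of x)ᵀᴴ * (Matrix.of x)ᵀ = Matrix.diagonal fun a => (g a : ℂ) := by
  ext a b
  rw [Matrix.diagonal_apply]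
  exact hx a b

variable [Fintype κ]

theorem schmidtNumber_le_card_of_coeffMatrix_eq [DecidableEq A]
    (hψ : coeffMatrix ψ = (Matrix.of x)ᵀ * Matrix.of y) : schmidtNumber ψ ≤ Fintype.card κ := by
  rw [schmidtNumber_eq_rank, hψ]
  exact (Matrix.rank_mul_le_left _ _).trans (Matrix.rank_le_card_width _)

variable [DecidableEq κ] {g : κ → ℝ}

theorem sum_norm_sq_of_orthogonal (hψ : coeffMatrix ψ = (Matrix.of x)ᵀ * Matrix.of y)
    (hx : ∀ a b, star (x a) ⬝ᵥ x b = if a = b then (g a : ℂ) else 0) :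
    ∑ i, ‖ψ i‖ ^ 2 = ∑ a, g a * ∑ j, ‖y a j‖ ^ 2 := by
  refine Complex.ofReal_injective ?_
  calc ((∑ i, ‖ψ i‖ ^ 2 : ℝ) : ℂ) = (reduced ψ).trace := (trace_reduced ψ).symm
    _ = ((Matrix.of y * (Matrix.of y)ᴴ) * ((Matrix.of x)ᵀᴴ * (Matrix.of x)ᵀ)).trace := by
        rw [reduced, hψ, Matrix.conjTranspose_mul, Matrix.mul_assoc, Matrix.trace_mul_comm]
        simp only [Matrix.mul_assoc]
    _ = ∑ a, (g a : ℂ) * (star (y a) ⬝ᵥ y a) := by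
        rw [conjTranspose_mul_self_of_orthogonal hx, Matrix.trace]
        refine Finset.sum_congr rfl fun a _ => ?_
        rw [Matrix.diag_apply, Matrix.mul_diagonal, mul_comm, dotProduct_comm]
        rfl
    _ = _ := by
        simp only [star_dotProduct_self, Complex.ofReal_sum, Complex.ofReal_mul]

theorem trace_reduced_mul_reduced_of_orthogonal
    (hψ : coeffMatrix ψ = (Matrix.of x)ᵀ * Matrix.of y)
    (hx : ∀ a b, star (x a) ⬝ᵥ x b = if a = b then (g a : ℂ) else 0) :
    (reduced ψ * reduced ψ).trace =
      ((∑ a, ∑ b, g a * g b * ‖star (y a) ⬝ᵥ y b‖ ^ 2 : ℝ) : ℂ) := by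
  set X := (Matrix.of x)ᵀ
  set h := Matrix.of y * (Matrix.of y)ᴴ
  have h_apply : ∀ a b, h a b = star (y b) ⬝ᵥ y a := fun a b => dotProduct_comm _ _
  have reduced_eq : reduced ψ = X * (h * Xᴴ) := by
    rw [reduced, hψ, Matrix.conjTranspose_mul]
    simp only [h, Matrix.mul_assoc]
  calc (reduced ψ * reduced ψ).trace = (h * (Xᴴ * X) * (h * (Xᴴ * X))).trace := by
        rw [reduced_eq, Matrix.mul_assoc, Matrix.trace_mul_comm]
        simp only [Matrix.mul_assoc]
    _ = ∑ a, ∑ b, h a b * g b * (h b a * g a) := by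
        rw [conjTranspose_mul_self_of_orthogonal hx]
        simp only [Matrix.trace, Matrix.diag_apply, Matrix.mul_apply (M := h * _),
          Matrix.mul_diagonal]
    _ = _ := by
        push_cast
        refine Finset.sum_congr rfl fun a _ => Finset.sum_congr rfl fun b _ => ?_
        rw [h_apply a b, h_apply b a, ← Complex.mul_conj' (star (y a) ⬝ᵥ y b),
          ← Complex.star_def, ← Matrix.star_dotProduct]
        ring

theorem exists_entanglement_eq_binEntropy_of_orthogonal [DecidableEq A]
    {x : Fin 2 → A → ℂ} {y : Fin 2 → B → ℂ} {g : Fin 2 → ℝ}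
    (hψ : coeffMatrix ψ = (Matrix.of x)ᵀ * Matrix.of y)
    (hx : ∀ a b, star (x a) ⬝ᵥ x b = if a = b then (g a : ℂ) else 0) (hg : g 0 + g 1 = 1)
    (hy : ∀ a, IsPureState (y a)) :
    ∃ t ∈ Set.Icc (0 : ℝ) 1, entanglement ψ = Real.binEntropy t / Real.log 2 ∧
      (t - 2⁻¹) ^ 2 = (g 0 - 2⁻¹) ^ 2 + g 0 * g 1 * ‖star (y 0) ⬝ᵥ y 1‖ ^ 2 := by
  have pure : IsPureState ψ := by
    rw [IsPureState, sum_norm_sq_of_orthogonal hψ hx, Fin.sum_univ_two, hy 0, hy 1, mul_one,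
      mul_one, hg]
  obtain ⟨t, ht, entanglement_eq, purity⟩ := exists_entanglement_eq_binEntropy pure
    (schmidtNumber_le_card_of_coeffMatrix_eq hψ)
  refine ⟨t, ht, entanglement_eq, ?_⟩
  have self : ∀ a, ‖star (y a) ⬝ᵥ y a‖ = 1 := fun a => by
    rw [star_dotProduct_self, hy a, Complex.ofReal_one, norm_one]
  have symm : ‖star (y 1) ⬝ᵥ y 0‖ = ‖star (y 0) ⬝ᵥ y 1‖ := by
    rw [Matrix.star_dotProduct, norm_star]
  rw [trace_reduced_mul_reduced_of_orthogonal hψ hx, Complex.ofReal_inj] at purity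
  simp only [Fin.sum_univ_two, self, symm] at purity
  rw [← eq_sub_iff_add_eq'] at hg
  rw [hg] at purity ⊢
  linear_combination -purity / 2

end OrthogonalExpansion

section ProductInputs

/-- The action of a single-qubit operator on a qubit that comes with a local ancilla. -/
def qubitAction {p : ℕ} (A : Matrix (Fin 2) (Fin 2) ℂ) (α : Fin 2 × Fin p → ℂ) :
    Fin 2 × Fin p → ℂ :=
  (A ⊗ₖ (1 : Matrix (Fin p) (Fin p) ℂ)) *ᵥ α

/-- The probability that the qubit of `w α` is found in the state `a`. -/
def controlProb {p : ℕ} (w : Matrix.unitaryGroup (Fin 2) ℂ) (α : Fin 2 × Fin p → ℂ) (a : Fin 2) :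
    ℝ :=
  ∑ s, ‖qubitAction w.1 α (a, s)‖ ^ 2

variable {p q : ℕ} {α : Fin 2 × Fin p → ℂ} {β : Fin 2 × Fin q → ℂ}

theorem qubitAction_apply (A : Matrix (Fin 2) (Fin 2) ℂ) (i : Fin 2) (s : Fin p) :
    qubitAction A α (i, s) = ∑ j, A i j * α (j, s) := by
  simp [qubitAction, Matrix.mulVec, dotProduct, Fintype.sum_prod_type, Matrix.one_apply]

theorem qubitAction_mul (A B : Matrix (Fin 2) (Fin 2) ℂ) :
    qubitAction (A * B) α = qubitAction A (qubitAction B α) := by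
  rw [qubitAction, qubitAction, qubitAction, Matrix.mulVec_mulVec, ← Matrix.mul_kronecker_mul,
    Matrix.one_mul]

theorem star_qubitAction_dotProduct (A : Matrix (Fin 2) (Fin 2) ℂ) (γ : Fin 2 × Fin p → ℂ) :
    star (qubitAction A α) ⬝ᵥ γ = star α ⬝ᵥ qubitAction Aᴴ γ := by
  rw [qubitAction, qubitAction, Matrix.star_mulVec, Matrix.conjTranspose_kronecker,
    Matrix.conjTranspose_one, Matrix.dotProduct_mulVec]

theorem isPureState_iff_star_dotProduct {ι : Type*} [Fintype ι] {x : ι → ℂ} :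
    IsPureState x ↔ star x ⬝ᵥ x = 1 := by
  rw [star_dotProduct_self, IsPureState, Complex.ofReal_eq_one]

theorem isPureState_qubitAction (u : Matrix.unitaryGroup (Fin 2) ℂ) (hα : IsPureState α) :
    IsPureState (qubitAction u.1 α) := by
  have isometry : u.1ᴴ * u.1 = 1 := Unitary.coe_star_mul_self u
  rw [isPureState_iff_star_dotProduct, star_qubitAction_dotProduct, ← qubitAction_mul, isometry,
    qubitAction, Matrix.one_kronecker_one, Matrix.one_mulVec, isPureState_iff_star_dotProduct.1 hα]

theorem sum_controlProb (w : Matrix.unitaryGroup (Fin 2) ℂ) (hα : IsPureState α) :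
    controlProb w α 0 + controlProb w α 1 = 1 := by
  simpa only [controlProb, IsPureState, Fintype.sum_prod_type, Fin.sum_univ_two] using
    isPureState_qubitAction w hα

theorem coeffMatrix_applyToProduct {κ : Type*} [Fintype κ]
    (A B : κ → Matrix (Fin 2) (Fin 2) ℂ) :
    coeffMatrix (applyToProduct (∑ a, A a ⊗ₖ B a) α β) =
      (Matrix.of fun a => qubitAction (A a) α)ᵀ * Matrix.of fun a => qubitAction (B a) β := by
  ext ⟨i, s⟩ ⟨j, t⟩
  simp only [coeffMatrix, applyToProduct, Matrix.of_apply, Matrix.mul_apply,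
    Matrix.transpose_apply, Matrix.sum_apply, Matrix.kroneckerMap_apply, qubitAction_apply,
    Fin.sum_univ_two, Finset.sum_mul, ← Finset.sum_add_distrib]
  exact Finset.sum_congr rfl fun a _ => by ring

variable {v w : Matrix.unitaryGroup (Fin 2) ℂ} {G : Fin 2 → Matrix.unitaryGroup (Fin 2) ℂ}

theorem star_qubitAction_single_dotProduct (a b : Fin 2) :
    star (qubitAction (v.1 * Matrix.single a a 1 * w.1) α) ⬝ᵥ
        qubitAction (v.1 * Matrix.single b b 1 * w.1) α =
      if a = b then (controlProb w α a : ℂ) else 0 := by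
  have isometry : v.1ᴴ * v.1 = 1 := Unitary.coe_star_mul_self v
  set γ := qubitAction w.1 α with hγ
  have move : star (qubitAction (v.1 * Matrix.single a a 1 * w.1) α) ⬝ᵥ
      qubitAction (v.1 * Matrix.single b b 1 * w.1) α =
      star (qubitAction (Matrix.single a a (1 : ℂ)) γ) ⬝ᵥ
        qubitAction (Matrix.single b b (1 : ℂ)) γ := by
    rw [Matrix.mul_assoc, Matrix.mul_assoc, qubitAction_mul v.1, star_qubitAction_dotProduct,
      ← qubitAction_mul, ← Matrix.mul_assoc, isometry, Matrix.one_mul, qubitAction_mul,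
      qubitAction_mul]
  have project : ∀ (c i : Fin 2) (s : Fin p),
      qubitAction (Matrix.single c c (1 : ℂ)) γ (i, s) = if c = i then γ (i, s) else 0 := by
    intro c i s
    simp only [qubitAction_apply, Matrix.single_apply, ite_and, ite_mul, one_mul, zero_mul]
    split_ifs with h <;> simp [h]
  rw [move]
  simp only [dotProduct, Pi.star_apply, Fintype.sum_prod_type, project]
  rcases eq_or_ne a b with rfl | hab
  · simp [controlProb, Complex.conj_mul', ← hγ, apply_ite]
  · simp [hab]

theorem norm_trace_le_two_mul_norm_dotProduct (u : Matrix.unitaryGroup (Fin 2) ℂ)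
    (hβ : IsPureState β) : ‖u.1.trace‖ ≤ 2 * ‖star β ⬝ᵥ qubitAction u.1 β‖ := by
  set k := star β ⬝ᵥ qubitAction u.1 β with hk
  have star_k : star k = star β ⬝ᵥ qubitAction u.1ᴴ β := by
    rw [← star_qubitAction_dotProduct, Matrix.star_dotProduct, ← hk]
  have trace_eq : u.1.trace = k + u.1.det * star k := by
    calc u.1.trace = star β ⬝ᵥ qubitAction (u.1.trace • 1) β := by
          rw [qubitAction, Matrix.smul_kronecker, Matrix.one_kronecker_one, Matrix.smul_mulVec,
            Matrix.one_mulVec, dotProduct_smul, isPureState_iff_star_dotProduct.1 hβ, smul_eq_mul,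
            mul_one]
      _ = k + u.1.det * star k := by
          rw [← add_det_smul_conjTranspose, qubitAction, Matrix.add_kronecker,
            Matrix.smul_kronecker, Matrix.add_mulVec, Matrix.smul_mulVec, dotProduct_add,
            dotProduct_smul, star_k, smul_eq_mul]
          rfl
  calc ‖u.1.trace‖ ≤ ‖k‖ + ‖u.1.det * star k‖ := trace_eq ▸ norm_add_le _ _
    _ = 2 * ‖k‖ := by rw [norm_mul, norm_det_eq_one, norm_star, one_mul, two_mul]

theorem exists_entanglement_applyToProduct_eq (hα : IsPureState α) (hβ : IsPureState β) :
    ∃ t ∈ Set.Icc (0 : ℝ) 1,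
      entanglement (applyToProduct (multiplexer v w G) α β) = Real.binEntropy t / Real.log 2 ∧
      (t - 2⁻¹) ^ 2 = (controlProb w α 0 - 2⁻¹) ^ 2 + controlProb w α 0 * controlProb w α 1 *
        ‖star β ⬝ᵥ qubitAction ((G 0).1ᴴ * (G 1).1) β‖ ^ 2 := by
  have orthogonal := star_qubitAction_single_dotProduct (α := α) (v := v) (w := w)
  have pure := fun a => isPureState_qubitAction (G a) hβ
  have expansion : coeffMatrix (applyToProduct (multiplexer v w G) α β) = _ :=
    coeffMatrix_applyToProduct (fun a => v.1 * Matrix.single a a 1 * w.1) fun a => (G a).1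
  rw [qubitAction_mul, ← star_qubitAction_dotProduct]
  obtain ⟨t, ht, entanglement_eq, t_eq⟩ :=
    exists_entanglement_eq_binEntropy_of_orthogonal expansion orthogonal (sum_controlProb w hα) pure
  exact ⟨t, ht, entanglement_eq, t_eq⟩

theorem entanglement_applyToProduct_le_one (hα : IsPureState α) (hβ : IsPureState β) :
    entanglement (applyToProduct (multiplexer v w G) α β) ≤ 1 := by
  obtain ⟨t, -, entanglement_eq, -⟩ := exists_entanglement_applyToProduct_eq hα hβ
  rw [entanglement_eq, div_le_one (Real.log_pos one_lt_two)]
  exact Real.binEntropy_le_log_two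

theorem exists_entanglement_applyToProduct_eq_and_norm_trace_le (hα : IsPureState α)
    (hβ : IsPureState β) :
    ∃ t ∈ Set.Icc (0 : ℝ) 1,
      entanglement (applyToProduct (multiplexer v w G) α β) = Real.binEntropy t / Real.log 2 ∧
      ‖((G 0).1ᴴ * (G 1).1).trace‖ / 4 ≤ |t - 2⁻¹| := by
  obtain ⟨t, ht, entanglement_eq, t_eq⟩ :=
    exists_entanglement_applyToProduct_eq (v := v) (w := w) (G := G) hα hβ
  refine ⟨t, ht, entanglement_eq, ?_⟩
  set k := ‖star β ⬝ᵥ qubitAction ((G 0).1ᴴ * (G 1).1) β‖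
  have trace_le : ‖((G 0).1ᴴ * (G 1).1).trace‖ ≤ 2 * k :=
    norm_trace_le_two_mul_norm_dotProduct (star (G 0) * G 1) hβ
  have k_le : k ≤ 1 :=
    norm_star_dotProduct_le_one hβ (isPureState_qubitAction (star (G 0) * G 1) hβ)
  have prob_one : controlProb w α 1 = 1 - controlProb w α 0 :=
    eq_sub_of_add_eq' (sum_controlProb w hα)
  have half_k_le : (k / 2) ^ 2 ≤ (t - 2⁻¹) ^ 2 := by
    calc (k / 2) ^ 2 = k ^ 2 * (controlProb w α 0 - 2⁻¹) ^ 2 +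
          controlProb w α 0 * controlProb w α 1 * k ^ 2 := by rw [prob_one]; ring
      _ ≤ (t - 2⁻¹) ^ 2 := by
        rw [t_eq]
        gcongr
        exact mul_le_of_le_one_left (sq_nonneg _) (pow_le_one₀ (norm_nonneg _) k_le)
  calc ‖((G 0).1ᴴ * (G 1).1).trace‖ / 4 ≤ k / 2 := by linarith
    _ ≤ |t - 2⁻¹| := le_abs_self _ |>.trans (sq_le_sq.1 half_k_le)

theorem binEntropy_le_binEntropy_half_sub {t δ : ℝ} (ht : t ∈ Set.Icc (0 : ℝ) 1) (hδ : 0 ≤ δ)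
    (h : δ ≤ |t - 2⁻¹|) : Real.binEntropy t ≤ Real.binEntropy (2⁻¹ - δ) := by
  wlog ht' : t ≤ 2⁻¹ generalizing t
  · rw [← Real.binEntropy_one_sub]
    refine this ⟨by linarith [ht.2], by linarith [ht.1]⟩ ?_ (by linarith [not_le.1 ht'])
    rwa [abs_sub_comm, show (2⁻¹ : ℝ) - (1 - t) = t - 2⁻¹ by ring]
  rw [abs_of_nonpos (by linarith)] at h
  exact Real.binEntropy_strictMonoOn.monotoneOn ⟨ht.1, ht'⟩
    ⟨by linarith [ht.1], by linarith⟩ (by linarith)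

end ProductInputs

section EntanglingPower

theorem entanglingPower_le_coe {U : TwoQubitOp} {E : ℝ}
    (h : ∀ (p q : ℕ) (α : Fin 2 × Fin p → ℂ) (β : Fin 2 × Fin q → ℂ), IsPureState α →
      IsPureState β → entanglement (applyToProduct U α β) ≤ E) : entanglingPower U ≤ E :=
  iSup_le fun p => iSup_le fun q => iSup_le fun α => iSup_le fun β => iSup_le fun hα =>
    iSup_le fun hβ => EReal.coe_le_coe (h p q α β hα hβ)

theorem coe_entanglement_le_entanglingPower (U : TwoQubitOp) {p q : ℕ} {α : Fin 2 × Fin p → ℂ}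
    {β : Fin 2 × Fin q → ℂ} (hα : IsPureState α) (hβ : IsPureState β) :
    (entanglement (applyToProduct U α β) : EReal) ≤ entanglingPower U :=
  le_iSup_of_le p (le_iSup_of_le q (le_iSup_of_le α (le_iSup_of_le β
    (le_iSup_of_le hα (le_iSup_of_le hβ le_rfl)))))

variable {v w : Matrix.unitaryGroup (Fin 2) ℂ} {G : Fin 2 → Matrix.unitaryGroup (Fin 2) ℂ}

theorem entanglingPower_multiplexer_le_one : entanglingPower (multiplexer v w G) ≤ 1 :=
  entanglingPower_le_coe fun _ _ _ _ hα hβ => entanglement_applyToProduct_le_one hα hβ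

theorem entanglingPower_multiplexer_lt_one (hG : ((G 0).1ᴴ * (G 1).1).trace ≠ 0) :
    entanglingPower (multiplexer v w G) < 1 := by
  set δ := ‖((G 0).1ᴴ * (G 1).1).trace‖ / 4
  have δ_pos : 0 < δ := div_pos (norm_pos_iff.2 hG) four_pos
  have log_pos : 0 < Real.log 2 := Real.log_pos one_lt_two
  have bound_lt_one : Real.binEntropy (2⁻¹ - δ) / Real.log 2 < 1 := by
    rw [div_lt_one log_pos, Real.binEntropy_lt_log_two]
    exact (sub_lt_self _ δ_pos).ne
  refine (entanglingPower_le_coe fun p q α β hα hβ => ?_).trans_lt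
    (EReal.coe_lt_coe bound_lt_one)
  obtain ⟨t, ht, entanglement_eq, δ_le⟩ :=
    exists_entanglement_applyToProduct_eq_and_norm_trace_le (v := v) (w := w) (G := G) hα hβ
  rw [entanglement_eq]
  gcongr
  exact binEntropy_le_binEntropy_half_sub ht δ_pos.le δ_le

theorem exists_controlProb_eq_half (w : Matrix.unitaryGroup (Fin 2) ℂ) :
    ∃ α : Fin 2 × Fin 1 → ℂ, IsPureState α ∧ ∀ a, controlProb w α a = 2⁻¹ := by
  let γ : Fin 2 × Fin 1 → ℂ := fun _ => ((√2 : ℝ) : ℂ)⁻¹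
  have norm_sq : ‖((√2 : ℝ) : ℂ)⁻¹‖ ^ 2 = 2⁻¹ := by simp
  have pure : IsPureState γ := by
    simp [IsPureState, γ]
  have coisometry : w.1 * (star w).1 = 1 := Unitary.coe_mul_star_self w
  refine ⟨qubitAction (star w).1 γ, isPureState_qubitAction _ pure, fun a => ?_⟩
  rw [controlProb, ← qubitAction_mul, coisometry, qubitAction, Matrix.one_kronecker_one,
    Matrix.one_mulVec, Fintype.sum_unique, norm_sq]

theorem one_le_entanglingPower_multiplexer (hG : ((G 0).1ᴴ * (G 1).1).trace = 0) :
    1 ≤ entanglingPower (multiplexer v w G) := by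
  obtain ⟨α, hα, prob⟩ := exists_controlProb_eq_half w
  obtain ⟨e, unit, orthogonal⟩ :=
    exists_unit_orthogonal_mulVec_of_trace_eq_zero (u := star (G 0) * G 1) hG
  let β : Fin 2 × Fin 1 → ℂ := fun x => e x.1
  have hβ : IsPureState β := by
    rw [isPureState_iff_star_dotProduct, ← unit]
    simp [dotProduct, Fintype.sum_prod_type, β]
  have overlap : star β ⬝ᵥ qubitAction ((G 0).1ᴴ * (G 1).1) β = 0 := by
    rw [← orthogonal]
    simp only [dotProduct, Fintype.sum_prod_type, qubitAction_apply, Fintype.sum_unique]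
    rfl
  obtain ⟨t, -, entanglement_eq, t_eq⟩ :=
    exists_entanglement_applyToProduct_eq (v := v) (w := w) (G := G) hα hβ
  have t_eq_half : t = 2⁻¹ := by
    rw [overlap, prob, prob, norm_zero] at t_eq
    exact sub_eq_zero.1 (pow_eq_zero_iff two_ne_zero |>.1 (by linear_combination t_eq))
  have := coe_entanglement_le_entanglingPower (multiplexer v w G) hα hβ
  rwa [entanglement_eq, t_eq_half, Real.binEntropy_two_inv,
    div_self (Real.log_pos one_lt_two).ne', EReal.coe_one] at this

theorem entanglingPower_multiplexer_lt_one_iff :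
    entanglingPower (multiplexer v w G) < 1 ↔ ¬ LocallyEquivalent (multiplexer v w G) cnot := by
  constructor
  · intro lt_one equiv
    obtain ⟨v', w', G', h, hG'⟩ := exists_eq_multiplexer_of_locallyEquivalent_cnot equiv
    exact (h ▸ lt_one).not_ge (one_le_entanglingPower_multiplexer hG')
  · exact fun h => entanglingPower_multiplexer_lt_one
      fun hG => h (multiplexer_locallyEquivalent_cnot hG)

end EntanglingPower

section BellState

theorem exists_isMaximallyEntangled_schmidtNumber_eq_two : ∃ ψ : Fin 2 × Fin 2 → ℂ,
    IsPureState ψ ∧ schmidtNumber ψ = 2 ∧ IsMaximallyEntangled ψ := by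
  let ψ : Fin 2 × Fin 2 → ℂ := fun x => if x.1 = x.2 then ((√2 : ℝ) : ℂ)⁻¹ else 0
  have s_sq : ((√2 : ℝ) : ℂ)⁻¹ * ((√2 : ℝ) : ℂ)⁻¹ = 2⁻¹ := by
    rw [← mul_inv, ← Complex.ofReal_mul, Real.mul_self_sqrt zero_le_two, Complex.ofReal_ofNat]
  have reduced_eq : reduced ψ = ((2⁻¹ : ℝ) : ℂ) • 1 := by
    ext i j
    fin_cases i <;> fin_cases j <;> simp [reduced, coeffMatrix, Matrix.mul_apply, ψ, s_sq]
  have coeff_eq := schmidtCoeff_eq_sqrt_of_reduced_eq_smul_one reduced_eq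
  refine ⟨ψ, ?_, ?_, fun i j _ _ => (coeff_eq i).trans (coeff_eq j).symm⟩
  · simp only [IsPureState, Fintype.sum_prod_type, Fin.sum_univ_two, ψ]
    norm_num
  · rw [← card_schmidtIndex, Fintype.card_subtype, Finset.filter_true_of_mem, Finset.card_fin]
    intro i _
    rw [coeff_eq]
    positivity

end BellState

end LOCCCost

end

theorem mainTheorem1 (U : LOCCCost.TwoQubitOp)
    (hU : LOCCCost.IsControlledUnitary U)
    (hne : ¬ LOCCCost.LocallyEquivalent U 1) :
    -- a resource of Schmidt number 2 has to be maximally entangled, with exactly 1 ebit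
    (∀ (m n : ℕ) (ψ : Fin m × Fin n → ℂ),
      LOCCCost.IsPureState ψ → LOCCCost.schmidtNumber ψ = 2 →
      (∃ P : LOCCCost.LOCC 2 2 (2 * m) (2 * n), LOCCCost.Implements P ψ U) →
      LOCCCost.IsMaximallyEntangled ψ ∧ LOCCCost.entanglement ψ = 1) ∧
    -- conversely every such resource suffices, by a three-turn protocol
    (∀ (m n : ℕ) (ψ : Fin m × Fin n → ℂ),
      LOCCCost.IsPureState ψ → LOCCCost.schmidtNumber ψ = 2 →
      LOCCCost.IsMaximallyEntangled ψ →
      ∃ P : LOCCCost.LOCC 2 2 (2 * m) (2 * n), P.turns = 3 ∧ LOCCCost.Implements P ψ U) ∧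
    -- the minimum entanglement cost over resources of Schmidt number 2 is 1 ebit
    IsLeast {E : ℝ | ∃ (m n : ℕ) (ψ : Fin m × Fin n → ℂ),
      LOCCCost.IsPureState ψ ∧ LOCCCost.schmidtNumber ψ = 2 ∧
      (∃ P : LOCCCost.LOCC 2 2 (2 * m) (2 * n), LOCCCost.Implements P ψ U) ∧
      E = LOCCCost.entanglement ψ} 1 ∧
    -- the gap: the entangling power is smaller, except for the operations equivalent to CNOT
    LOCCCost.entanglingPower U ≤ 1 ∧
    (LOCCCost.entanglingPower U < 1 ↔ ¬ LOCCCost.LocallyEquivalent U LOCCCost.cnot) := by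
  obtain ⟨v, w, G, rfl⟩ := hU.exists_eq_multiplexer
  have rigid : ∀ (m n : ℕ) (ψ : Fin m × Fin n → ℂ),
      LOCCCost.IsPureState ψ → LOCCCost.schmidtNumber ψ = 2 →
      (∃ P : LOCCCost.LOCC 2 2 (2 * m) (2 * n),
        LOCCCost.Implements P ψ (LOCCCost.multiplexer v w G)) →
      LOCCCost.IsMaximallyEntangled ψ ∧ LOCCCost.entanglement ψ = 1 := by
    rintro m n ψ hψ hk ⟨P, hP⟩
    have hmax : LOCCCost.IsMaximallyEntangled ψ :=
      hP.isMaximallyEntangled LOCCCost.multiplexer_conjTranspose_mul_self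
        LOCCCost.linearIndependent_mul_single_mul
        (LOCCCost.linearIndependent_of_not_locallyEquivalent_one hne) rfl hk.symm
    refine ⟨hmax, ?_⟩
    rw [hmax.entanglement_eq hψ, hk, Nat.cast_ofNat, Real.logb_self_eq_one one_lt_two]
  refine ⟨rigid, fun m n ψ hψ hk hmax => hmax.exists_implements_multiplexer hψ hk v w G,
    ⟨?_, ?_⟩, LOCCCost.entanglingPower_multiplexer_le_one,
    LOCCCost.entanglingPower_multiplexer_lt_one_iff⟩
  · obtain ⟨ψ, hψ, hk, hmax⟩ := LOCCCost.exists_isMaximallyEntangled_schmidtNumber_eq_two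
    obtain ⟨P, -, hP⟩ := hmax.exists_implements_multiplexer hψ hk v w G
    exact ⟨2, 2, ψ, hψ, hk, ⟨P, hP⟩, (rigid 2 2 ψ hψ hk ⟨P, hP⟩).2.symm⟩
  · rintro E ⟨m, n, ψ, hψ, hk, hP, rfl⟩
    exact (rigid m n ψ hψ hk hP).2.ge
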